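/- Let $m\ge 1$, let $X=(X_i)_{i\ge1}$ and $Y=(Y_i)_{i\ge1}$ be two independent sequences of iid random variables with values in a finite alphabet $\mathcal{A}_m=\{\alpha_1,\dots,\alpha_m\}$, with $\mathbb{P}(X_i=\alpha_k)=\mathbb{P}(Y_i=\alpha_k)=p_k$ for all $i\ge 1$ and $1\le k\le m$. For words $x,y$ of length $n$, let $LC_n(x;y)$ be the length of their longest common subsequence, i.e. the largest $k$ for which there are $1\le i_1<\dots<i_k\le n$ and $1\le j_1<\dots<j_k\le n$ with $x_{i_s}=y_{j_s}$ for $s=1,\dots,k$, and let $LC_n=LC_n(X_1\cdots X_n;Y_1\cdots Y_n)$. Put $$K_0=2^{-4}\,10^{-2}e^{-67},\qquad K=\min\Bigl(K_0,\frac{1}{800m}\Bigr).$$ Assume that $p_{j_0}>1/2$ for some $j_0\in\{1,\dots,m\}$ and that $$\max_{j\ne j_0}p_j\le\min\Bigl(\frac{2^{-2}e^{-5}K}{m},\frac{K}{2m^2}\Bigr)$$ (the maximum over the empty set being $0$). Given $n\ge1$ and the words $X_1\cdots X_n$ and $Y_1\cdots Y_n$, pick a position uniformly at random among all positions of the two words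 whose letter is not $\alpha_{j_0}$, change the letter at this position into $\alpha_{j_0}$, and let $\widetilde{LC_n}$ be the length of the longest common subsequence of the two new words (if there is no such position, then $\widetilde{LC_n}=LC_n$). Then, for every $n\ge 1$, there is a set $\mathcal{B}_n\subset\mathcal{A}_m^n\times\mathcal{A}_m^n$ such that $$\mathbb{P}\bigl((X_1\cdots X_n,Y_1\cdots Y_n)\in\mathcal{B}_n\bigr)\ge 1-121\exp\Bigl(-\frac{n(\max_{j\ne j_0}p_j)^6}{5}\Bigr),$$ and such that, for all $(x,y)\in\mathcal{B}_n$, $$\mathbb{P}\bigl(\widetilde{LC_n}-LC_n=1\mid X_1\cdots X_n=x,\,Y_1\cdots Y_n=y\bigr)\ge\frac{K_0}{m},$$ $$\mathbb{P}\bigl(\widetilde{LC_n}-LC_n=-1\mid X_1\cdots X_n=x,\,Y_1\cdots Y_n=y\bigr)\le\frac{K}{2m}.$$ -/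

import Mathlib

open MeasureTheory ProbabilityTheory

namespace LCS

/-- `x` and `y` have a common subsequence of length `k`. -/
def HasCommonSubseq {A : Type*} {n : ℕ} (x y : Fin n → A) (k : ℕ) : Prop :=
  ∃ i j : Fin k → Fin n, StrictMono i ∧ StrictMono j ∧ ∀ s, x (i s) = y (j s)

/-- The length of the longest common subsequence of two words of length `n`
(the set is nonempty and bounded by `n`, so the supremum is a maximum). -/
noncomputable def lc {A : Type*} {n : ℕ} (x y : Fin n → A) : ℕ :=
  sSup {k | HasCommonSubseq x y k}

/-- The finite word made of the first `n` letters of a random sequence. -/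
def word {Ω A : Type*} (X : ℕ → Ω → A) (n : ℕ) (ω : Ω) : Fin n → A :=
  fun i => X i ω

/-- The event that the two words of length `n` are `x` and `y`. -/
def wordsEq {Ω A : Type*} {n : ℕ} (X Y : ℕ → Ω → A) (x y : Fin n → A) : Set Ω :=
  {ω | word X n ω = x ∧ word Y n ω = y}

/-- The positions in the pair `(x, y)` holding a letter other than `a`; `Sum.inl i` is the
position `i` of `x` and `Sum.inr i` is the position `i` of `y`. -/
def otherPositions {A : Type*} {n : ℕ} (a : A) (x y : Fin n → A) : Set (Fin n ⊕ Fin n) :=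
  {s | Sum.elim x y s ≠ a}

/-- The pair of words obtained from `(x, y)` by writing the letter `a` at the position `s`. -/
def changeAt {A : Type*} {n : ℕ} (a : A) (x y : Fin n → A) :
    Fin n ⊕ Fin n → (Fin n → A) × (Fin n → A)
  | Sum.inl i => (Function.update x i a, y)
  | Sum.inr i => (x, Function.update y i a)

/-- `J` picks, given the two words of length `n`, a position uniformly at random among those
holding a letter other than `a`. If there is no such position nothing is required of `J`:
all the letters are then equal to `a`, and `changeAt` leaves the words as they are. -/
def IsUniformPick {Ω A : Type*} [MeasurableSpace Ω] (μ : Measure Ω) {n : ℕ} (a : A)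
    (X Y : ℕ → Ω → A) (J : Ω → Fin n ⊕ Fin n) : Prop :=
  ∀ x y : Fin n → A, μ (wordsEq X Y x y) ≠ 0 → (otherPositions a x y).Nonempty →
    (μ[|wordsEq X Y x y]).map J = uniformOn (otherPositions a x y)

/-- `LC_n`, as a random variable. -/
noncomputable def LC {Ω A : Type*} (n : ℕ) (X Y : ℕ → Ω → A) (ω : Ω) : ℕ :=
  lc (word X n ω) (word Y n ω)

/-- The length of the longest common subsequence after the letter at the picked position `J`
has been changed into `a`. -/
noncomputable def changedLC {Ω A : Type*} {n : ℕ} (a : A) (X Y : ℕ → Ω → A)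
    (J : Ω → Fin n ⊕ Fin n) (ω : Ω) : ℕ :=
  let z := changeAt a (word X n ω) (word Y n ω) (J ω)
  lc z.1 z.2

/-- The constant `2⁻⁴ 10⁻² e⁻⁶⁷`. -/
noncomputable def K₀ : ℝ := 2⁻¹ ^ 4 * 10⁻¹ ^ 2 * Real.exp (-67)

/-- The constant `min (2⁻⁴ 10⁻² e⁻⁶⁷, 1 / (800 m))`. -/
noncomputable def K (m : ℕ) : ℝ := min K₀ (1 / (800 * m))

/-- `max_{j ≠ j₀} p_j` (equal to `0` if `j₀` is the only letter). -/
noncomputable def maxOther {m : ℕ} (p : Fin m → ℝ) (j₀ : Fin m) : ℝ :=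
  ⨆ j : {j : Fin m // j ≠ j₀}, p j

end LCS

/-! Let `o` be the frequent letter and call the others rare. Let q and s = 1 − q be the
probabilities of `o` and of a rare letter, ρ the probability that two independent letters are equal
and rare, and p the largest probability of a rare letter, so that p² ≤ ρ ≤ ps. An optimal alignment
is described by its k matched pairs of rare letters: they cut the words into pairs of segments, in
which only letters `o` are matched, as many as possible (`Align`). Writing `o` over a rare letter
can shorten the common subsequence only if that letter is matched, which concerns at most 2k
positions (`Align.decCount_le`). It lengthens the subsequence at every rare letter lying in the
segment with fewer letters `o` of its pair; let rl be the number of these (`Align.le_incCount`).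
There are about 2ns rare letters in all, so it suffices that, up to a small probability, k < 200nρ
and rl is at least a tiny fraction of ns.

Both are exponential Markov bounds. Alignments receive multiplicative weights, and the expected
total weight of all decompositions of the two words is controlled by a supersolution of a finite
transfer system (`lenSum_decSum_le`). For k, a matched rare pair costs ρ, and optimality bounds the
number of unmatched letters `o` by about 2k (`sum_wt_align_le`).

For rl, each matched `o` is rewarded by 1 + ρ/100, while unmatched letters `o` and the letters
counted by rl are penalized (`sum_wt_optimal_align_le`). In unequal segments the penalties beat the
reward. Equal segments carry no penalty, and there optimality is used: a run of them matches the
i-th `o` with the i-th `o`, and if it contains (roo, oro) and later (soo, oso) with no diagonal rare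
match available in between, shifting the matching of the letters `o` by one gains two rare matches
and loses one `o` (`ShiftPair.commonSublist`). Hence, when the run is read in groups of two letters
`o`, a rich group separates any two shift groups. Shift groups have mass at least about ρ and rich
ones at most about 2ρ, so this constraint costs a factor 1 − cρ per group, which beats the reward
(`reach_run`, `Align.reach`).

Hoeffding's inequality makes the counts of `o` typical, and `inc_dec_or_exists_align` combines the
three estimates. -/

namespace LCS

open List

/-! ### Common sublists -/

section CommonSublists

variable {A : Type*}

/-- The lists `x` and `y` have a common sublist of length at least `k`. -/
def CommonSublist (x y : List A) (k : ℕ) : Prop :=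
  ∃ l : List A, l <+ x ∧ l <+ y ∧ k ≤ l.length

theorem CommonSublist.mono {x y : List A} {k k' : ℕ} (h : CommonSublist x y k) (hk : k' ≤ k) :
    CommonSublist x y k' := by
  obtain ⟨l, h1, h2, h3⟩ := h
  exact ⟨l, h1, h2, hk.trans h3⟩

theorem CommonSublist.symm {x y : List A} {k : ℕ} (h : CommonSublist x y k) :
    CommonSublist y x k := by
  obtain ⟨l, h1, h2, h3⟩ := h
  exact ⟨l, h2, h1, h3⟩

theorem CommonSublist.append {a b x y : List A} {k k' : ℕ} (h : CommonSublist a b k)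
    (h' : CommonSublist x y k') : CommonSublist (a ++ x) (b ++ y) (k + k') := by
  obtain ⟨l, h1, h2, h3⟩ := h
  obtain ⟨l', h1', h2', h3'⟩ := h'
  exact ⟨l ++ l', h1.append h1', h2.append h2', by simp; omega⟩

theorem CommonSublist.singleton (r : A) : CommonSublist [r] [r] 1 :=
  ⟨[r], Sublist.refl _, Sublist.refl _, by simp⟩

theorem CommonSublist.nil : CommonSublist ([] : List A) [] 0 :=
  ⟨[], Sublist.refl _, Sublist.refl _, by simp⟩

/-- At most one letter of a common sublist sits at the changed position; deleting it leaves a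
sublist of `x`. So one change raises the optimum by at most one. -/
theorem CommonSublist.set_succ {x y : List A} {k i : ℕ} {c : A}
    (h : CommonSublist (x.set i c) y (k + 1)) : CommonSublist x y k := by
  obtain ⟨l, h1, h2, h3⟩ := h
  suffices ∃ l', l' <+ x ∧ l' <+ l ∧ l.length ≤ l'.length + 1 by
    obtain ⟨l', h4, h5, h6⟩ := this
    exact ⟨l', h4, h5.trans h2, by omega⟩
  clear h2 h3
  induction x generalizing l i with
  | nil => exact ⟨l, by simpa using h1, Sublist.refl _, by omega⟩
  | cons a x ih =>
    cases i with
    | zero =>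
      simp only [List.set_cons_zero] at h1
      cases h1 with
      | cons _ h => exact ⟨l, h.cons _, Sublist.refl _, by omega⟩
      | cons_cons _ h => exact ⟨_, h.cons _, sublist_cons_self _ _, by simp⟩
    | succ i =>
      simp only [List.set_cons_succ] at h1
      cases h1 with
      | cons _ h =>
        obtain ⟨l', h4, h5, h6⟩ := ih _ h
        exact ⟨l', h4.cons _, h5, h6⟩
      | cons_cons _ h =>
        obtain ⟨l', h4, h5, h6⟩ := ih _ h
        exact ⟨_, h4.cons_cons a, h5.cons_cons a, by simp; omega⟩

theorem cons_sublist_split {c : A} {l x : List A} (h : c :: l <+ x) :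
    ∃ x₁ x₂, x = x₁ ++ c :: x₂ ∧ l <+ x₂ := by
  induction x with
  | nil => simp at h
  | cons d x ih =>
    cases h with
    | cons _ h =>
      obtain ⟨x₁, x₂, rfl, h2⟩ := ih h
      exact ⟨d :: x₁, x₂, rfl, h2⟩
    | cons_cons _ h => exact ⟨[], x, rfl, h⟩

/-- Every common sublist of `x` and `y` has length at most `v`. -/
def MaxCommon (x y : List A) (v : ℕ) : Prop := ∀ k, CommonSublist x y k → k ≤ v

/-- A gain in one factor would be a gain for the concatenation: optimality passes to the parts of an
optimal alignment. -/
theorem MaxCommon.of_append_left {a b x y : List A} {v w : ℕ}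
    (h : MaxCommon (a ++ x) (b ++ y) (v + w)) (hw : CommonSublist x y w) : MaxCommon a b v := by
  intro k hk
  have := h _ (hk.append hw)
  omega

theorem MaxCommon.of_append_right {a b x y : List A} {v w : ℕ}
    (h : MaxCommon (a ++ x) (b ++ y) (v + w)) (hv : CommonSublist a b v) : MaxCommon x y w := by
  intro k hk
  have := h _ (hv.append hk)
  omega

variable [DecidableEq A] (o : A)

theorem commonSublist_of_le_count {x y : List A} {k : ℕ} (hx : k ≤ x.count o)
    (hy : k ≤ y.count o) : CommonSublist x y k :=
  ⟨replicate k o, replicate_sublist_iff.2 hx, replicate_sublist_iff.2 hy, by simp⟩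

/-- The number of letters of `l` other than `o`. -/
def rares (l : List A) : ℕ := l.countP (fun c => decide (c ≠ o))

@[simp] theorem rares_nil : rares o ([] : List A) = 0 := rfl

theorem rares_cons (c : A) (l : List A) :
    rares o (c :: l) = rares o l + if c = o then 0 else 1 := by
  by_cases h : c = o <;> simp [rares, h]

theorem count_add_rares (l : List A) : l.count o + rares o l = l.length := by
  induction l with
  | nil => simp
  | cons c l ih =>
    by_cases h : c = o <;> simp [rares_cons, h] <;> omega

end CommonSublists

/-! ### The effect of changing one letter -/

section Changes

open scoped Classical in
/-- The number of positions of `x` with a letter other than `o` such that writing `o` there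
creates a common sublist with `y` of length more than `v`. -/
noncomputable def incCount {A : Type*} [DecidableEq A] (o : A) (x y : List A) (v : ℕ) : ℕ :=
  Nat.count (fun i => x.getD i o ≠ o ∧ CommonSublist (x.set i o) y (v + 1)) x.length

open scoped Classical in
/-- The number of positions of `x` with a letter other than `o` such that writing `o` there
destroys all common sublists with `y` of length at least `v`. -/
noncomputable def decCount {A : Type*} [DecidableEq A] (o : A) (x y : List A) (v : ℕ) : ℕ :=
  Nat.count (fun i => x.getD i o ≠ o ∧ ¬ CommonSublist (x.set i o) y v) x.length

variable {A : Type*} [DecidableEq A] (o : A)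

/-- While one factor is improved the other keeps its common sublist. Matches across the two factors
are ignored, so only an inequality holds. -/
theorem incCount_append {a b x y : List A} {v w : ℕ} (h : CommonSublist a b v)
    (h' : CommonSublist x y w) :
    incCount o a b v + incCount o x y w ≤ incCount o (a ++ x) (b ++ y) (v + w) := by
  classical
  unfold incCount
  rw [List.length_append, Nat.count_add]
  refine Nat.add_le_add (Nat.count_mono_left fun i hi hp => ?_)
    (Nat.count_mono_left fun i hi hp => ?_)
  · refine ⟨by rw [List.getD_append _ _ _ _ hi]; exact hp.1, ?_⟩
    rw [List.set_append, if_pos hi]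
    exact (hp.2.append h').mono (by omega)
  · refine ⟨by rw [List.getD_append_right _ _ _ _ (by omega)]; simpa using hp.1, ?_⟩
    rw [List.set_append, if_neg (by omega), Nat.add_sub_cancel_left]
    exact (h.append hp.2).mono (by omega)

theorem decCount_append {a b x y : List A} {v w : ℕ} (h : CommonSublist a b v)
    (h' : CommonSublist x y w) :
    decCount o (a ++ x) (b ++ y) (v + w) ≤ decCount o a b v + decCount o x y w := by
  classical
  unfold decCount
  rw [List.length_append, Nat.count_add]
  refine Nat.add_le_add (Nat.count_mono_left fun i hi hp => ?_)
    (Nat.count_mono_left fun i hi hp => ?_)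
  · rw [List.getD_append _ _ _ _ hi, List.set_append, if_pos hi] at hp
    exact ⟨hp.1, fun hc => hp.2 (hc.append h')⟩
  · rw [List.getD_append_right _ _ _ _ (by omega), List.set_append, if_neg (by omega),
      Nat.add_sub_cancel_left] at hp
    exact ⟨hp.1, fun hc => hp.2 (h.append hc)⟩

theorem decCount_singleton (r : A) : decCount o [r] [r] 1 ≤ 1 := by
  classical
  exact Nat.count_le _

theorem count_getD_ne (l : List A) :
    Nat.count (fun i => l.getD i o ≠ o) l.length = rares o l := by
  induction l with
  | nil => simp
  | cons c l ih =>
    rw [List.length_cons, Nat.count_succ', rares_cons]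
    simp only [List.getD_cons_succ, List.getD_cons_zero, ih]
    by_cases h : c = o <;> simp [h]

theorem count_set_of_getD_ne {l : List A} {i : ℕ} (hi : i < l.length) (h : l.getD i o ≠ o) :
    (l.set i o).count o = l.count o + 1 := by
  rw [List.count_set hi]
  rw [List.getD_eq_getElem _ _ hi] at h
  simp [h]

/-- Writing `o` never removes an `o`, so a matching that uses only letters `o` survives. -/
theorem decCount_min (a b : List A) : decCount o a b (min (a.count o) (b.count o)) = 0 := by
  classical
  unfold decCount
  refine Nat.eq_zero_of_le_zero (le_trans (Nat.count_mono_left (q := fun _ => False)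
    fun i hi hp => ?_) (by simp))
  obtain ⟨h1, h2⟩ := hp
  apply h2
  have := count_set_of_getD_ne o hi h1
  exact commonSublist_of_le_count o (by omega) (by omega)

/-- Each new `o` in the poorer list finds a spare partner in the richer one. -/
theorem rares_le_incCount {a b : List A} (h : a.count o < b.count o) :
    rares o a ≤ incCount o a b (min (a.count o) (b.count o)) := by
  classical
  rw [← count_getD_ne]
  unfold incCount
  refine Nat.count_mono_left fun i hi hp => ⟨hp, ?_⟩
  have := count_set_of_getD_ne o hi hp
  exact commonSublist_of_le_count o (by omega) (by omega)

end Changes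

/-! ### Alignments -/

section Alignments

variable {A : Type*} [DecidableEq A] (o : A)

/-- The difference of the numbers of letters `o` in two lists. -/
def gap (a b : List A) : ℕ := (a.count o - b.count o) + (b.count o - a.count o)

/-- The number of letters other than `o` in the list with strictly fewer letters `o`. -/
def lowRares (a b : List A) : ℕ :=
  if a.count o < b.count o then rares o a else if b.count o < a.count o then rares o b else 0

/-- An alignment of `x` and `y`: `k` pairs of equal letters other than `o` are matched; they cut
the lists into pairs of segments, in which as many letters `o` as possible are matched. The
indices `mn`, `tv` and `rl` are the sums over these pairs of the number of matched letters `o`, of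
the unmatched letters `o`, and of `lowRares`. -/
inductive Align : List A → List A → ℕ → ℕ → ℕ → ℕ → Prop
  | last (u v : List A) :
      Align u v 0 (min (u.count o) (v.count o)) (gap o u v) (lowRares o u v)
  | cons (a b : List A) (r : A) (hr : r ≠ o) {x y : List A} {k mn tv rl : ℕ}
      (h : Align x y k mn tv rl) :
      Align (a ++ r :: x) (b ++ r :: y) (k + 1) (min (a.count o) (b.count o) + mn)
        (gap o a b + tv) (lowRares o a b + rl)

variable {o}

theorem Align.commonSublist {x y : List A} {k mn tv rl : ℕ} (h : Align o x y k mn tv rl) :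
    CommonSublist x y (k + mn) := by
  induction h with
  | last u v => exact commonSublist_of_le_count o (by omega) (by omega)
  | cons a b r hr h ih =>
    refine ((commonSublist_of_le_count o (min_le_left _ _) (min_le_right _ _)).append
      ((CommonSublist.singleton r).append ih)).mono ?_
    omega

theorem Align.count_add_count {x y : List A} {k mn tv rl : ℕ} (h : Align o x y k mn tv rl) :
    x.count o + y.count o = 2 * mn + tv := by
  induction h with
  | last u v => unfold gap; omega
  | cons a b r hr h ih =>
    simp only [List.count_append, List.count_cons, gap, beq_iff_eq, if_neg hr]
    omega

/-- The segments contribute nothing by `decCount_min`, and each matched rare pair contributes at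
most one position per word; `decCount_append` adds these up. -/
theorem Align.decCount_le {x y : List A} {k mn tv rl : ℕ} (h : Align o x y k mn tv rl) :
    decCount o x y (k + mn) ≤ k ∧ decCount o y x (k + mn) ≤ k := by
  induction h with
  | last u v =>
    rw [zero_add]
    refine ⟨(decCount_min o u v).le, ?_⟩
    rw [min_comm]
    exact (decCount_min o v u).le
  | @cons a b r hr x y k mn tv rl h ih =>
    have h1 := commonSublist_of_le_count o (min_le_left (a.count o) (b.count o))
      (min_le_right _ _)
    have h2 := (CommonSublist.singleton r).append h.commonSublist
    have e : k + 1 + (min (a.count o) (b.count o) + mn)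
      = min (a.count o) (b.count o) + (1 + (k + mn)) := by omega
    rw [e]
    constructor
    · have h3 := decCount_append o h1 h2
      have h4 := decCount_append o (CommonSublist.singleton r) h.commonSublist
      have h5 := decCount_singleton o r
      rw [decCount_min] at h3
      have h6 := ih.1
      simp only [List.singleton_append] at h3 h4
      omega
    · have h3 := decCount_append o h1.symm h2.symm
      have h4 := decCount_append o (CommonSublist.singleton r) h.commonSublist.symm
      have h5 := decCount_singleton o r
      rw [min_comm, decCount_min, min_comm] at h3
      have h6 := ih.2
      simp only [List.singleton_append] at h3 h4
      omega

theorem lowRares_le_incCount (a b : List A) :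
    lowRares o a b ≤ incCount o a b (min (a.count o) (b.count o)) +
      incCount o b a (min (a.count o) (b.count o)) := by
  unfold lowRares
  split_ifs with h1 h2
  · exact (rares_le_incCount o h1).trans (Nat.le_add_right _ _)
  · rw [min_comm]
    exact (rares_le_incCount o h2).trans (Nat.le_add_left _ _)
  · exact Nat.zero_le _

theorem Align.le_incCount {x y : List A} {k mn tv rl : ℕ} (h : Align o x y k mn tv rl) :
    rl ≤ incCount o x y (k + mn) + incCount o y x (k + mn) := by
  induction h with
  | last u v => rw [zero_add]; exact lowRares_le_incCount u v
  | @cons a b r hr x y k mn tv rl h ih =>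
    have h1 := commonSublist_of_le_count o (min_le_left (a.count o) (b.count o))
      (min_le_right _ _)
    have h2 := (CommonSublist.singleton r).append h.commonSublist
    have e : k + 1 + (min (a.count o) (b.count o) + mn)
      = min (a.count o) (b.count o) + (1 + (k + mn)) := by omega
    rw [e]
    have h3 := incCount_append o h1 h2
    have h4 := incCount_append o (CommonSublist.singleton r) h.commonSublist
    have h5 := incCount_append o h1.symm h2.symm
    have h6 := incCount_append o (CommonSublist.singleton r) h.commonSublist.symm
    have h7 := lowRares_le_incCount (o := o) a b
    simp only [List.singleton_append] at h3 h4 h5 h6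
    omega

/-- The new `o` joins the first pair of segments and raises its minimum by at least one; letters `o`
in `a` and `b` may raise it further. -/
theorem Align.prepend {x y : List A} {k mn tv rl : ℕ} (h : Align o x y k mn tv rl)
    (a b : List A) : ∃ k' mn' tv' rl', Align o (a ++ o :: x) (b ++ o :: y) k' mn' tv' rl' ∧
      k + mn + 1 ≤ k' + mn' := by
  cases h with
  | last u v =>
    refine ⟨_, _, _, _, Align.last _ _, ?_⟩
    simp only [List.count_append, List.count_cons, beq_self_eq_true, if_true]
    omega
  | cons a' b' r hr h =>
    have h' := Align.cons (a ++ o :: a') (b ++ o :: b') r hr h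
    simp only [List.append_assoc, List.cons_append] at h'
    refine ⟨_, _, _, _, h', ?_⟩
    · simp only [List.count_append, List.count_cons, beq_self_eq_true, if_true]
      omega

variable (o) in
-- The rare letters of `l` become the cuts. The letters `o` of `l` between two cuts lie in one pair
-- of segments, which matches at least as many.
theorem exists_align_of_sublist {l x y : List A} (hx : l <+ x) (hy : l <+ y) :
    ∃ k mn tv rl, Align o x y k mn tv rl ∧ l.length ≤ k + mn := by
  induction l generalizing x y with
  | nil => exact ⟨_, _, _, _, Align.last x y, by simp⟩
  | cons c l ih =>
    obtain ⟨x₁, x₂, rfl, hx'⟩ := cons_sublist_split hx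
    obtain ⟨y₁, y₂, rfl, hy'⟩ := cons_sublist_split hy
    obtain ⟨k, mn, tv, rl, h, hl⟩ := ih hx' hy'
    by_cases hc : c = o
    · subst hc
      obtain ⟨k', mn', tv', rl', h', hl'⟩ := h.prepend x₁ y₁
      exact ⟨k', mn', tv', rl', h', by simp; omega⟩
    · exact ⟨_, _, _, _, Align.cons x₁ y₁ c hc h, by simp; omega⟩

variable (o) in
theorem exists_align_of_maxCommon {x y : List A} {v : ℕ} (h : CommonSublist x y v)
    (hv : MaxCommon x y v) : ∃ k mn tv rl, Align o x y k mn tv rl ∧ k + mn = v := by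
  obtain ⟨l, h1, h2, h3⟩ := h
  obtain ⟨k, mn, tv, rl, ha, hl⟩ := exists_align_of_sublist o h1 h2
  exact ⟨k, mn, tv, rl, ha, le_antisymm (hv _ ha.commonSublist) (by omega)⟩

end Alignments

end LCS

namespace LCS

open List

/-! ### Alignments matching the letters `o` in order -/

section DiagonalAlignments

variable {A : Type*} (o : A)

/-- `a` and `b` can be aligned, matching `v` pairs of letters, so that for every `i` the `i`-th
letter `o` of `a` is matched with the `i`-th letter `o` of `b`. -/
inductive Diag : List A → List A → ℕ → Prop
  | nil : Diag [] [] 0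
  | left {a b : List A} {v : ℕ} (r : A) (hr : r ≠ o) (h : Diag a b v) : Diag (r :: a) b v
  | right {a b : List A} {v : ℕ} (r : A) (hr : r ≠ o) (h : Diag a b v) : Diag a (r :: b) v
  | both {a b : List A} {v : ℕ} (c : A) (h : Diag a b v) : Diag (c :: a) (c :: b) (v + 1)

/-- `g` ends with `o` and has `k` other occurrences of `o`. -/
def ZeroBlock [DecidableEq A] (k : ℕ) (g : List A) : Prop :=
  ∃ l : List A, g = l ++ [o] ∧ l.count o = k

variable {o}

theorem Diag.commonSublist {a b : List A} {v : ℕ} (h : Diag o a b v) : CommonSublist a b v := by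
  induction h with
  | nil => exact CommonSublist.nil
  | left r hr h ih =>
    obtain ⟨l, h1, h2, h3⟩ := ih
    exact ⟨l, h1.cons _, h2, h3⟩
  | right r hr h ih =>
    obtain ⟨l, h1, h2, h3⟩ := ih
    exact ⟨l, h1, h2.cons _, h3⟩
  | both c h ih =>
    exact ((CommonSublist.singleton c).append ih).mono (by omega)

theorem Diag.append {a b a' b' : List A} {v v' : ℕ} (h : Diag o a b v) (h' : Diag o a' b' v') :
    Diag o (a ++ a') (b ++ b') (v + v') := by
  induction h with
  | nil => simpa using h'
  | left r hr h ih => exact ih.left r hr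
  | right r hr h ih => exact ih.right r hr
  | both c h ih =>
    rw [show ∀ v, v + 1 + v' = v + v' + 1 by omega]
    exact ih.both c

variable [DecidableEq A]

theorem Diag.count_eq {a b : List A} {v : ℕ} (h : Diag o a b v) : a.count o = b.count o := by
  induction h with
  | nil => rfl
  | left r hr h ih => simpa [List.count_cons, hr] using ih
  | right r hr h ih => simpa [List.count_cons, hr] using ih
  | both c h ih => simp [List.count_cons, ih]

theorem diag_of_count_eq {a b : List A} (h : a.count o = b.count o) :
    Diag o a b (a.count o) := by
  induction a generalizing b with
  | nil =>
    induction b with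
    | nil => exact Diag.nil
    | cons d b ih =>
      by_cases hd : d = o
      · simp [hd] at h
      · exact (ih (by simpa [List.count_cons, hd] using h)).right d hd
  | cons c a ih =>
    by_cases hc : c = o
    · subst hc
      induction b with
      | nil => simp at h
      | cons d b ih' =>
        by_cases hd : d = c
        · subst hd
          rw [List.count_cons_self]
          exact (ih (by simpa using h)).both _
        · exact (ih' (by simpa [List.count_cons, hd] using h)).right d hd
    · rw [List.count_cons_of_ne (by simpa using hc)] at h ⊢
      exact (ih h).left c hc

theorem ZeroBlock.cons_of_ne {k : ℕ} {g : List A} (h : ZeroBlock o k g) {r : A} (hr : r ≠ o) :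
    ZeroBlock o k (r :: g) := by
  obtain ⟨l, rfl, h⟩ := h
  exact ⟨r :: l, rfl, by simpa [List.count_cons, hr] using h⟩

theorem ZeroBlock.cons_self {k : ℕ} {g : List A} (h : ZeroBlock o k g) :
    ZeroBlock o (k + 1) (o :: g) := by
  obtain ⟨l, rfl, h⟩ := h
  exact ⟨o :: l, rfl, by simpa using h⟩

theorem ZeroBlock.count_eq {k : ℕ} {g : List A} (h : ZeroBlock o k g) : g.count o = k + 1 := by
  obtain ⟨l, rfl, h⟩ := h
  simp [h]

/-- Cut both lists just after their `o` of index `k` (counted from 0). These two are matched with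
each other, so the remainders are again diagonally aligned. -/
theorem Diag.exists_split {a b : List A} {v : ℕ} (h : Diag o a b v) (k : ℕ)
    (hk : k < a.count o) : ∃ g a' g' b' v₁ v₂, a = g ++ a' ∧ b = g' ++ b' ∧ v = v₁ + v₂ ∧
      Diag o g g' v₁ ∧ Diag o a' b' v₂ ∧ ZeroBlock o k g ∧ ZeroBlock o k g' := by
  induction h generalizing k with
  | nil => simp at hk
  | left r hr h ih =>
    obtain ⟨g, a', g', b', v₁, v₂, rfl, rfl, rfl, h1, h2, h3, h4⟩ :=
      ih k (by simpa [List.count_cons, hr] using hk)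
    exact ⟨r :: g, a', g', b', v₁, v₂, rfl, rfl, rfl, h1.left r hr, h2, h3.cons_of_ne hr, h4⟩
  | right r hr h ih =>
    obtain ⟨g, a', g', b', v₁, v₂, rfl, rfl, rfl, h1, h2, h3, h4⟩ := ih k hk
    exact ⟨g, a', r :: g', b', v₁, v₂, rfl, rfl, rfl, h1.right r hr, h2, h3, h4.cons_of_ne hr⟩
  | @both a b v c h ih =>
    by_cases hc : c = o
    · subst hc
      cases k with
      | zero =>
        exact ⟨[c], a, [c], b, 1, v, rfl, rfl, by omega, Diag.nil.both c, h,
          ⟨[], rfl, rfl⟩, ⟨[], rfl, rfl⟩⟩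
      | succ k =>
        obtain ⟨g, a', g', b', v₁, v₂, rfl, rfl, rfl, h1, h2, h3, h4⟩ :=
          ih k (by simpa using hk)
        exact ⟨c :: g, a', c :: g', b', v₁ + 1, v₂, rfl, rfl, by omega, h1.both c, h2,
          h3.cons_self, h4.cons_self⟩
    · obtain ⟨g, a', g', b', v₁, v₂, rfl, rfl, rfl, h1, h2, h3, h4⟩ :=
        ih k (by simpa [List.count_cons, hc] using hk)
      exact ⟨c :: g, a', c :: g', b', v₁ + 1, v₂, rfl, rfl, by omega, h1.both c, h2,
        h3.cons_of_ne hc, h4.cons_of_ne hc⟩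

/-- A diagonal alignment that matches more than the letters `o` matches a pair of equal letters
other than `o` preceded by equally many letters `o`. -/
theorem Diag.exists_rare_match {a b : List A} {v : ℕ} (h : Diag o a b v) (hv : a.count o < v) :
    ∃ a₁ a₂ b₁ b₂ r, r ≠ o ∧ a = a₁ ++ r :: a₂ ∧ b = b₁ ++ r :: b₂ ∧
      a₁.count o = b₁.count o := by
  induction h with
  | nil => simp at hv
  | left r hr h ih =>
    obtain ⟨a₁, a₂, b₁, b₂, s, hs, rfl, rfl, h1⟩ := ih (by simpa [List.count_cons, hr] using hv)
    exact ⟨r :: a₁, a₂, b₁, b₂, s, hs, rfl, rfl, by simpa [List.count_cons, hr] using h1⟩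
  | right r hr h ih =>
    obtain ⟨a₁, a₂, b₁, b₂, s, hs, rfl, rfl, h1⟩ := ih hv
    exact ⟨a₁, a₂, r :: b₁, b₂, s, hs, rfl, rfl, by simpa [List.count_cons, hr] using h1⟩
  | @both a b v c h ih =>
    by_cases hc : c = o
    · subst hc
      obtain ⟨a₁, a₂, b₁, b₂, s, hs, rfl, rfl, h1⟩ := ih (by simpa using hv)
      exact ⟨c :: a₁, a₂, c :: b₁, b₂, s, hs, rfl, rfl, by simpa using h1⟩
    · exact ⟨[], a, [], b, c, hc, rfl, rfl, rfl⟩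

variable (o) in
/-- The pair `(r o o, o r o)`, in which the letter `r` can be matched at the cost of one letter
`o`. -/
def ShiftPair (g g' : List A) : Prop := ∃ r, r ≠ o ∧ g = [r, o, o] ∧ g' = [o, r, o]

variable (o) in
/-- The pair `(g, g')` has a diagonal alignment with at least three matches. -/
def RichPair (g g' : List A) : Prop := ∃ v, 2 < v ∧ Diag o g g' v

/-- The letter `r` is preceded by no `o` on one side and by one on the other, so a diagonal
alignment cannot match it. -/
theorem ShiftPair.not_richPair {g g' : List A} (h : ShiftPair o g g') : ¬ RichPair o g g' := by
  obtain ⟨r, hr, rfl, rfl⟩ := h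
  rintro ⟨v, hv, h⟩
  obtain ⟨a₁, a₂, b₁, b₂, s, hs, h1, h2, h3⟩ := h.exists_rare_match (by simpa [hr] using hv)
  rcases a₁ with _ | ⟨c, a₁⟩
  · rcases b₁ with _ | ⟨d, b₁⟩
    · simp at h2; exact hs h2.1.symm
    · simp at h2; simp [h2.1.symm] at h3
  · simp only [List.cons_append, List.cons.injEq] at h1
    have hm : s ∈ [o, o] := by rw [h1.2]; simp
    simp at hm
    exact hs hm

theorem ShiftPair.count_left {g g' : List A} (h : ShiftPair o g g') : g.count o = 2 := by
  obtain ⟨r, hr, rfl, rfl⟩ := h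
  simp [hr]

theorem ShiftPair.count_right {g g' : List A} (h : ShiftPair o g g') : g'.count o = 2 := by
  obtain ⟨r, hr, rfl, rfl⟩ := h
  simp [hr]

/-- Two shift pairs one after the other allow for one more match than the letters `o` alone. -/
theorem ShiftPair.commonSublist {g g' f f' k k' : List A} (h : ShiftPair o g g')
    (h' : ShiftPair o f f') (hk : k.count o = k'.count o) :
    CommonSublist (g ++ k ++ f) (g' ++ k' ++ f') (k.count o + 5) := by
  obtain ⟨r, hr, rfl, rfl⟩ := h
  obtain ⟨s, hs, rfl, rfl⟩ := h'
  -- Skip the first `o` of `g'` and match `r`; then `o o k` against `o k' o` gives `k.count o + 2`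
  -- matches, the last `o` being borrowed from `f'`; then match `s` and one `o`. The letters `o`
  -- alone give `k.count o + 4`.
  have h1 : CommonSublist [] [o] 0 := ⟨[], by simp, by simp, by simp⟩
  have h2 : CommonSublist ([o, o] ++ k) ([o] ++ k' ++ [o]) (k.count o + 2) :=
    commonSublist_of_le_count o (by simp) (by simp [hk])
  have h3 : CommonSublist [o, o] [o] 1 := ⟨[o], by simp, by simp, by simp⟩
  have := ((h1.append (CommonSublist.singleton r)).append h2).append
    ((CommonSublist.singleton s).append h3)
  refine CommonSublist.mono (k := 0 + 1 + (k.count o + 2) + (1 + 1)) ?_ (by omega)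
  simpa using this

end DiagonalAlignments

end LCS

namespace LCS

open List
open scoped ENNReal

/-! ### Weighted sums over lists -/

section ListSums

variable {A : Type*}

theorem tsum_list_le_of_trunc {h : List A → ℝ≥0∞} {b : ℝ≥0∞}
    (hb : ∀ N, ∑' l, (if l.length < N then h l else 0) ≤ b) : ∑' l, h l ≤ b := by
  rw [ENNReal.tsum_eq_iSup_sum]
  refine iSup_le fun s => ?_
  refine le_trans ?_ (hb (s.sup List.length + 1))
  refine le_trans ?_ (ENNReal.sum_le_tsum s)
  refine Finset.sum_le_sum fun l hl => ?_
  rw [if_pos (Nat.lt_succ_of_le (Finset.le_sup (f := List.length) hl))]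

/-- The weight of a list: the product of the weights of its letters. -/
noncomputable def wt (c : A → ℝ≥0∞) (l : List A) : ℝ≥0∞ := (l.map c).prod

@[simp] theorem wt_nil (c : A → ℝ≥0∞) : wt c [] = 1 := rfl

theorem wt_cons (c : A → ℝ≥0∞) (a : A) (l : List A) : wt c (a :: l) = c a * wt c l := by
  simp [wt]

theorem wt_append (c : A → ℝ≥0∞) (l l' : List A) : wt c (l ++ l') = wt c l * wt c l' := by
  simp [wt]

variable [Fintype A]

theorem tsum_list (h : List A → ℝ≥0∞) :
    ∑' l, h l = h [] + ∑ c, ∑' l, h (c :: l) := by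
  classical
  rw [ENNReal.tsum_eq_add_tsum_ite []]
  congr 1
  have hinj : Function.Injective (fun q : A × List A => q.1 :: q.2) := by
    rintro ⟨a, l⟩ ⟨b, l'⟩ h
    simpa using h
  have e := hinj.tsum_eq (f := fun l => if l = [] then 0 else h l) (by
    intro l hl
    cases l with
    | nil => simp at hl
    | cons a l => exact ⟨(a, l), rfl⟩)
  refine Eq.trans (tsum_congr fun l => ?_) (e.symm.trans ?_)
  · by_cases hl : l = [] <;> simp [hl]
  · rw [ENNReal.tsum_prod', tsum_fintype]
    simp

/-- The total weight of the lists of a given length. -/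
theorem tsum_wt_length (c : A → ℝ≥0∞) (n : ℕ) :
    ∑' l, (if l.length = n then wt c l else 0) = (∑ a, c a) ^ n := by
  induction n with
  | zero =>
    rw [tsum_list]
    simp
  | succ n ih =>
    rw [tsum_list]
    simp only [List.length_nil, List.length_cons, Nat.add_right_cancel_iff, wt_cons]
    rw [if_neg (by omega), zero_add, pow_succ', Finset.sum_mul]
    refine Finset.sum_congr rfl fun a _ => ?_
    rw [← ih, ← ENNReal.tsum_mul_left]
    refine tsum_congr fun l => ?_
    split_ifs <;> simp

variable [DecidableEq A] (o : A)

/-- The total weight of the lists with `k` letters `o`. -/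
theorem tsum_wt_count_le (c : A → ℝ≥0∞) {D : ℝ≥0∞} (hD : D ≠ 0) (hD' : D ≠ ⊤)
    (h : (∑ a ∈ Finset.univ.erase o, c a) + D = 1) (k : ℕ) :
    ∑' l, (if l.count o = k then wt c l else 0) ≤ c o ^ k * D⁻¹ ^ (k + 1) := by
  refine tsum_list_le_of_trunc fun N => ?_
  induction N generalizing k with
  | zero => simp
  | succ N ih =>
    rw [tsum_list]
    rw [← Finset.add_sum_erase Finset.univ _ (Finset.mem_univ o)]
    set s := ∑ a ∈ Finset.univ.erase o, c a with hs
    have hrare : ∑ a ∈ Finset.univ.erase o, ∑' l : List A,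
        (if (a :: l).length < N + 1 then if (a :: l).count o = k then wt c (a :: l) else 0
          else 0) ≤ s * (c o ^ k * D⁻¹ ^ (k + 1)) := by
      rw [hs, Finset.sum_mul]
      refine Finset.sum_le_sum fun a ha => ?_
      refine le_trans (le_of_eq ?_) (mul_le_mul_right (ih k) (c a))
      rw [← ENNReal.tsum_mul_left]
      refine tsum_congr fun l => ?_
      rw [List.count_cons_of_ne (by simpa using Finset.ne_of_mem_erase ha), wt_cons]
      simp only [List.length_cons, Nat.add_lt_add_iff_right]
      split_ifs <;> simp
    -- The bound T is the fixed point of T = sT + c(o)^k D^{-k}, according to whether the first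
    -- letter is rare or `o` (or the list is empty, if k = 0). The k + 1 factors D⁻¹ are geometric
    -- series for the rare letters around the k letters `o`.
    have hfix : s * (c o ^ k * D⁻¹ ^ (k + 1)) + c o ^ k * D⁻¹ ^ k = c o ^ k * D⁻¹ ^ (k + 1) := by
      have : c o ^ k * D⁻¹ ^ k = D * (c o ^ k * D⁻¹ ^ (k + 1)) := by
        calc c o ^ k * D⁻¹ ^ k = (D * D⁻¹) * (c o ^ k * D⁻¹ ^ k) := by
              rw [ENNReal.mul_inv_cancel hD hD', one_mul]
          _ = _ := by ring
      rw [this, ← add_mul, h, one_mul]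
    cases k with
    | zero =>
      have ho : ∑' l : List A, (if (o :: l).length < N + 1 then
          if (o :: l).count o = 0 then wt c (o :: l) else 0 else 0) = 0 := by
        simp
      rw [ho, zero_add]
      refine le_trans (add_le_add_right hrare _) ?_
      refine le_trans (le_of_eq ?_) hfix.le
      rw [add_comm]
      simp
    | succ k =>
      have ho : ∑' l : List A, (if (o :: l).length < N + 1 then
          if (o :: l).count o = k + 1 then wt c (o :: l) else 0 else 0) ≤
          c o ^ (k + 1) * D⁻¹ ^ (k + 1) := by
        rw [pow_succ', mul_assoc]
        refine le_trans (le_of_eq ?_) (mul_le_mul_right (ih k) (c o))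
        rw [← ENNReal.tsum_mul_left]
        refine tsum_congr fun l => ?_
        rw [List.count_cons_self, wt_cons]
        simp only [List.length_cons, Nat.add_lt_add_iff_right, Nat.add_right_cancel_iff]
        split_ifs <;> simp
      have hnil : (if ([] : List A).length < N + 1 then
          if ([] : List A).count o = k + 1 then wt c [] else 0 else 0) = 0 := by simp
      rw [hnil, zero_add]
      refine le_trans (add_le_add ho hrare) ?_
      rw [add_comm, hfix]

/-- A weighted sum over lists of a function of the number of letters `o`. -/
theorem tsum_wt_mul_count_le (c : A → ℝ≥0∞) {D : ℝ≥0∞} (hD : D ≠ 0) (hD' : D ≠ ⊤)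
    (h : (∑ a ∈ Finset.univ.erase o, c a) + D = 1) (f : ℕ → ℝ≥0∞) :
    ∑' l, wt c l * f (l.count o) ≤ ∑' k, c o ^ k * D⁻¹ ^ (k + 1) * f k := by
  calc ∑' l, wt c l * f (l.count o)
      = ∑' l : List A, ∑' k, (if l.count o = k then wt c l else 0) * f k := by
        refine tsum_congr fun l => ?_
        rw [tsum_eq_single (l.count o)]
        · simp
        · intro k hk; simp [hk.symm]
    _ = ∑' k, (∑' l : List A, (if l.count o = k then wt c l else 0)) * f k := by
        rw [ENNReal.tsum_comm]
        exact tsum_congr fun k => ENNReal.tsum_mul_right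
    _ ≤ _ := ENNReal.tsum_le_tsum fun k =>
        mul_le_mul_left (tsum_wt_count_le o c hD hD' h k) _

end ListSums

/-! ### Sums over decompositions of pairs of lists -/

section Decompositions

variable {A S : Type*} [Fintype S]

open scoped Classical in
/-- The sum over all decompositions of the pair `x` of lists into at most `N` pairs, with
transitions between the states in `S`, of the products of the weights of the pairs; `W` is the
weight of a transition and `V` that of the last pair. -/
noncomputable def decSum (W : S → S → List A × List A → ℝ≥0∞) (V : S → List A × List A → ℝ≥0∞) :
    ℕ → S → List A × List A → ℝ≥0∞
  | 0, _, _ => 0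
  | N + 1, s, x => V s x + ∑ s', ∑' a : List A × List A, ∑' x' : List A × List A,
      if x = (a.1 ++ x'.1, a.2 ++ x'.2) then W s s' a * decSum W V N s' x' else 0

variable {W : S → S → List A × List A → ℝ≥0∞} {V : S → List A × List A → ℝ≥0∞}

theorem decSum_mono {N N' : ℕ} (h : N ≤ N') (s : S) (x : List A × List A) :
    decSum W V N s x ≤ decSum W V N' s x := by
  induction N generalizing N' s x with
  | zero => simp [decSum]
  | succ N ih =>
    obtain ⟨M, rfl⟩ : ∃ M, N' = M + 1 := ⟨N' - 1, by omega⟩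
    simp only [decSum]
    gcongr with s' _ a x'
    split_ifs
    · gcongr
      exact ih (by omega) _ _
    · rfl

variable (W V) in
/-- Some decomposition of `(x, y)`, starting from the state `s`, has weight at least `t`. -/
def Reach (s : S) (x y : List A) (t : ℝ≥0∞) : Prop := ∃ N, t ≤ decSum W V N s (x, y)

theorem Reach.mono {s : S} {x y : List A} {t t' : ℝ≥0∞} (h : Reach W V s x y t) (ht : t' ≤ t) :
    Reach W V s x y t' := by
  obtain ⟨N, h⟩ := h
  exact ⟨N, ht.trans h⟩

theorem Reach.last {s : S} {x y : List A} {t : ℝ≥0∞} (h : t ≤ V s (x, y)) :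
    Reach W V s x y t := by
  refine ⟨1, ?_⟩
  simp only [decSum]
  exact h.trans le_self_add

theorem Reach.cons {s s' : S} {a b x y : List A} {t w : ℝ≥0∞} (h : Reach W V s' x y t)
    (hw : w ≤ W s s' (a, b)) : Reach W V s (a ++ x) (b ++ y) (w * t) := by
  classical
  obtain ⟨N, h⟩ := h
  refine ⟨N + 1, ?_⟩
  simp only [decSum]
  refine le_trans ?_ le_add_self
  refine le_trans ?_ (Finset.single_le_sum (fun _ _ => zero_le) (Finset.mem_univ s'))
  refine le_trans ?_ (ENNReal.le_tsum (a, b))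
  refine le_trans ?_ (ENNReal.le_tsum (x, y))
  rw [if_pos rfl]
  exact mul_le_mul' hw h

/-- The weight of a pair of lists. -/
noncomputable def wt₂ (c : A → ℝ≥0∞) (x : List A × List A) : ℝ≥0∞ := wt c x.1 * wt c x.2

/-- The sum over all pairs of lists of given lengths. -/
noncomputable def lenSum (c : A → ℝ≥0∞) (n n' : ℕ) (f : List A × List A → ℝ≥0∞) : ℝ≥0∞ :=
  ∑' x : List A × List A, if x.1.length = n ∧ x.2.length = n' then wt₂ c x * f x else 0

/-- `φ` is a supersolution of φ = C + Mφ, and splitting off the first pair gives the induction on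
`N`. Lengths are fixed because the last pair is unconstrained and would otherwise have infinite
total weight; the transitions are summed over all lengths. -/
theorem lenSum_decSum_le (c : A → ℝ≥0∞) {C φ : S → ℝ≥0∞}
    (hC : ∀ s n n', lenSum c n n' (V s) ≤ C s)
    (hφ : ∀ s, C s + ∑ s', (∑' a, wt₂ c a * W s s' a) * φ s' ≤ φ s) (N : ℕ) (s : S) (n n' : ℕ) :
    lenSum c n n' (decSum W V N s) ≤ φ s := by
  classical
  induction N generalizing s n n' with
  | zero => simp [lenSum, decSum]
  | succ N ih =>
    refine le_trans ?_ (hφ s)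
    have key : lenSum c n n' (decSum W V (N + 1) s) = lenSum c n n' (V s) +
        ∑ s', ∑' a : List A × List A, ∑' x' : List A × List A,
          if a.1.length + x'.1.length = n ∧ a.2.length + x'.2.length = n' then
            wt₂ c a * W s s' a * (wt₂ c x' * decSum W V N s' x') else 0 := by
      have : ∀ x : List A × List A, (if x.1.length = n ∧ x.2.length = n' then
          wt₂ c x * decSum W V (N + 1) s x else 0) =
          (if x.1.length = n ∧ x.2.length = n' then wt₂ c x * V s x else 0) +
          ∑ s', ∑' a : List A × List A, ∑' x' : List A × List A,
            if x = (a.1 ++ x'.1, a.2 ++ x'.2) then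
              if x.1.length = n ∧ x.2.length = n' then
                wt₂ c x * (W s s' a * decSum W V N s' x') else 0 else 0 := by
        intro x
        split_ifs with hx
        · simp only [decSum, mul_add, Finset.mul_sum, ← ENNReal.tsum_mul_left, mul_ite, mul_zero]
        · simp
      unfold lenSum
      rw [tsum_congr this, ENNReal.tsum_add]
      congr 1
      rw [Summable.tsum_finsetSum (fun _ _ => ENNReal.summable)]
      refine Finset.sum_congr rfl fun s' _ => ?_
      rw [ENNReal.tsum_comm]
      refine tsum_congr fun a => ?_
      rw [ENNReal.tsum_comm]
      refine tsum_congr fun x' => ?_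
      rw [tsum_ite_eq]
      simp only [List.length_append, wt₂, wt_append]
      split_ifs
      · ring
      · rfl
    rw [key]
    refine add_le_add (hC s n n') (Finset.sum_le_sum fun s' _ => ?_)
    rw [← ENNReal.tsum_mul_right]
    refine ENNReal.tsum_le_tsum fun a => ?_
    by_cases ha : a.1.length ≤ n ∧ a.2.length ≤ n'
    · refine le_trans (le_of_eq ?_)
        (mul_le_mul_right (ih s' (n - a.1.length) (n' - a.2.length)) _)
      unfold lenSum
      rw [← ENNReal.tsum_mul_left]
      refine tsum_congr fun x' => ?_
      rw [mul_ite, mul_zero]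
      refine if_congr ?_ rfl rfl
      omega
    · refine le_trans (le_of_eq ?_) zero_le
      rw [ENNReal.tsum_eq_zero]
      intro x'
      rw [if_neg (by omega)]

/-- Markov's inequality for the weight of decompositions. -/
theorem sum_wt_le_of_reach (c : A → ℝ≥0∞) {C φ : S → ℝ≥0∞}
    (hC : ∀ s n n', lenSum c n n' (V s) ≤ C s)
    (hφ : ∀ s, C s + ∑ s', (∑' a, wt₂ c a * W s s' a) * φ s' ≤ φ s) (s : S) (n : ℕ) (t : ℝ≥0∞)
    (B : Finset ((Fin n → A) × (Fin n → A)))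
    (hB : ∀ x ∈ B, Reach W V s (List.ofFn x.1) (List.ofFn x.2) t) :
    t * ∑ x ∈ B, wt c (List.ofFn x.1) * wt c (List.ofFn x.2) ≤ φ s := by
  choose! N hN using hB
  refine le_trans ?_ (lenSum_decSum_le c hC hφ (B.sup N) s n n)
  have hinj : Function.Injective
      (fun x : (Fin n → A) × (Fin n → A) => (List.ofFn x.1, List.ofFn x.2)) := by
    rintro ⟨x, y⟩ ⟨x', y'⟩ h
    simp only [Prod.mk.injEq] at h
    exact Prod.ext (List.ofFn_injective h.1) (List.ofFn_injective h.2)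
  unfold lenSum
  refine le_trans ?_ (ENNReal.tsum_comp_le_tsum_of_injective hinj _)
  refine le_trans ?_ (ENNReal.sum_le_tsum B)
  rw [Finset.mul_sum]
  refine Finset.sum_le_sum fun x hx => ?_
  rw [if_pos (by simp), mul_comm]
  exact mul_le_mul_right ((hN x hx).trans (decSum_mono (Finset.le_sup hx) _ _)) _

end Decompositions

end LCS

namespace LCS

open List
open scoped ENNReal

/-! ### Sums over pairs of lists -/

section PairSums

/-- A union bound over a parametrization, which need not be injective. -/
theorem tsum_exists_le {α ι : Type*} (f : ι → α) (p : ι → Prop) [DecidablePred p]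
    (q : α → Prop) [DecidablePred q] (hq : ∀ x, q x → ∃ i, x = f i ∧ p i) (w : α → ℝ≥0∞) :
    ∑' x, (if q x then w x else 0) ≤ ∑' i, if p i then w (f i) else 0 := by
  classical
  calc ∑' x, (if q x then w x else 0)
      ≤ ∑' x, ∑' i, (if x = f i then (if p i then w (f i) else 0) else 0) := by
        refine ENNReal.tsum_le_tsum fun x => ?_
        split_ifs with h
        · obtain ⟨i, rfl, hi⟩ := hq x h
          refine le_trans ?_ (ENNReal.le_tsum i)
          simp [hi]
        · exact zero_le
    _ = _ := by
        rw [ENNReal.tsum_comm]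
        refine tsum_congr fun i => ?_
        rw [tsum_ite_eq]

theorem tsum_tsum_le_add (F : ℕ → ℕ → ℝ≥0∞) :
    ∑' i, ∑' j, F i j ≤ ∑' i, ∑' d, F i (i + d) + ∑' i, ∑' d, F (i + d) i := by
  have key : ∀ G : ℕ → ℕ → ℝ≥0∞,
      ∑' i, ∑' j, (if i ≤ j then G i j else 0) ≤ ∑' i, ∑' d, G i (i + d) := by
    intro G
    refine ENNReal.tsum_le_tsum fun i => ?_
    refine le_trans (tsum_exists_le (fun d => i + d) (fun _ => True) (fun j => i ≤ j)
      (fun j hj => ⟨j - i, (Nat.add_sub_of_le hj).symm, trivial⟩) (G i)) ?_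
    simp
  calc ∑' i, ∑' j, F i j
      ≤ ∑' i, ∑' j, ((if i ≤ j then F i j else 0) + (if j ≤ i then F i j else 0)) := by
        refine ENNReal.tsum_le_tsum fun i => ENNReal.tsum_le_tsum fun j => ?_
        by_cases h : i ≤ j
        · simp [h]
        · simp [(not_le.1 h).le]
    _ = ∑' i, ∑' j, (if i ≤ j then F i j else 0) +
          ∑' j, ∑' i, (if j ≤ i then F i j else 0) := by
        simp only [ENNReal.tsum_add]
        congr 1
        exact ENNReal.tsum_comm
    _ ≤ _ := add_le_add (key F) (key fun j i => F i j)

variable {A : Type*} [Fintype A]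

/-- The total weight of the pairs of lists of given lengths. -/
theorem tsum_length_mul (c d : A → ℝ≥0∞) (n n' : ℕ) :
    ∑' x : List A × List A, (if x.1.length = n ∧ x.2.length = n' then wt c x.1 * wt d x.2 else 0) =
      (∑ a, c a) ^ n * (∑ a, d a) ^ n' := by
  rw [ENNReal.tsum_prod', ← tsum_wt_length, ← tsum_wt_length, ← ENNReal.tsum_mul_right]
  refine tsum_congr fun a => ?_
  rw [← ENNReal.tsum_mul_left]
  refine tsum_congr fun b => ?_
  by_cases h1 : a.length = n <;> by_cases h2 : b.length = n' <;> simp [h1, h2]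

variable [DecidableEq A] (o : A)

theorem tsum_pair_count_le (c d : A → ℝ≥0∞) {D E : ℝ≥0∞} (hD : D ≠ 0) (hD' : D ≠ ⊤)
    (hE : E ≠ 0) (hE' : E ≠ ⊤) (hc : (∑ a ∈ Finset.univ.erase o, c a) + D = 1)
    (hd : (∑ a ∈ Finset.univ.erase o, d a) + E = 1) (F : ℕ → ℕ → ℝ≥0∞) :
    ∑' x : List A × List A, wt c x.1 * wt d x.2 * F (x.1.count o) (x.2.count o) ≤
      ∑' i, ∑' j, (c o ^ i * D⁻¹ ^ (i + 1)) * (d o ^ j * E⁻¹ ^ (j + 1)) * F i j := by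
  rw [ENNReal.tsum_prod']
  calc ∑' (a : List A) (b : List A), wt c a * wt d b * F (a.count o) (b.count o)
      = ∑' a : List A, wt c a * ∑' b : List A, wt d b * F (a.count o) (b.count o) := by
        refine tsum_congr fun a => ?_
        rw [← ENNReal.tsum_mul_left]
        exact tsum_congr fun b => mul_assoc _ _ _
    _ ≤ ∑' a : List A, wt c a * ∑' j, d o ^ j * E⁻¹ ^ (j + 1) * F (a.count o) j := by
        gcongr with a
        exact tsum_wt_mul_count_le o d hE hE' hd (F (a.count o))
    _ ≤ ∑' i, c o ^ i * D⁻¹ ^ (i + 1) * ∑' j, d o ^ j * E⁻¹ ^ (j + 1) * F i j :=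
        tsum_wt_mul_count_le o c hD hD' hc fun i => ∑' j, d o ^ j * E⁻¹ ^ (j + 1) * F i j
    _ = _ := by
        refine tsum_congr fun i => ?_
        rw [← ENNReal.tsum_mul_left]
        exact tsum_congr fun j => by ring

theorem pow_mul_inv_pow_succ {q : ℝ≥0∞} (h : q ≠ 0) (h' : q ≠ ⊤) (k : ℕ) :
    q ^ k * q⁻¹ ^ (k + 1) = q⁻¹ := by
  rw [pow_succ, ← mul_assoc, ← mul_pow, ENNReal.mul_inv_cancel h h', one_pow, one_mul]

/-- Weights of letters forming a probability distribution in which `o` has positive mass. -/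
structure IsLaw (P : A → ℝ≥0∞) : Prop where
  sum_eq : ∑ a, P a = 1
  ne_zero : P o ≠ 0

variable {o} {P : A → ℝ≥0∞}

theorem IsLaw.rare_add (hP : IsLaw o P) : (∑ a ∈ Finset.univ.erase o, P a) + P o = 1 := by
  rw [Finset.sum_erase_add _ _ (Finset.mem_univ o), hP.sum_eq]

theorem IsLaw.ne_top (hP : IsLaw o P) : P o ≠ ⊤ :=
  ne_top_of_le_ne_top ENNReal.one_ne_top (hP.rare_add ▸ le_add_self)

/-- For a probability law D = P(o), so the lists with i letters `o` have total weight at most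
1/P(o), whatever i is. -/
theorem IsLaw.tsum_pair_count_le (hP : IsLaw o P) (F : ℕ → ℕ → ℝ≥0∞) :
    ∑' x : List A × List A, wt₂ P x * F (x.1.count o) (x.2.count o) ≤
      (P o)⁻¹ ^ 2 * ∑' i, ∑' j, F i j := by
  refine le_trans (LCS.tsum_pair_count_le o P P hP.ne_zero hP.ne_top hP.ne_zero hP.ne_top
    hP.rare_add hP.rare_add F) (le_of_eq ?_)
  simp only [pow_mul_inv_pow_succ hP.ne_zero hP.ne_top, ENNReal.tsum_mul_left]
  rw [sq]

theorem IsLaw.tsum_count_le (hP : IsLaw o P) (k : ℕ) :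
    ∑' l : List A, (if l.count o = k then wt P l else 0) ≤ (P o)⁻¹ := by
  refine le_trans (tsum_wt_count_le o P hP.ne_zero hP.ne_top hP.rare_add k) ?_
  rw [pow_mul_inv_pow_succ hP.ne_zero hP.ne_top]

variable (o P) in
/-- The probability that two letters are equal and different from `o`. -/
noncomputable def coinc : ℝ≥0∞ := ∑ r ∈ Finset.univ.erase o, P r ^ 2

variable (o) in
open scoped Classical in
/-- The weight `f` of the pair of lists that remains when a common last letter different from `o`
is removed. -/
noncomputable def rareEnd (f : List A × List A → ℝ≥0∞) (x : List A × List A) : ℝ≥0∞ :=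
  ∑ r ∈ Finset.univ.erase o, ∑' a : List A × List A,
    if x = (a.1 ++ [r], a.2 ++ [r]) then f a else 0

theorem le_rareEnd (f : List A × List A → ℝ≥0∞) {r : A} (hr : r ≠ o) (a b : List A) :
    f (a, b) ≤ rareEnd o f (a ++ [r], b ++ [r]) := by
  unfold rareEnd
  refine le_trans ?_ (Finset.single_le_sum (fun _ _ => zero_le)
    (Finset.mem_erase.2 ⟨hr, Finset.mem_univ r⟩))
  refine le_trans ?_ (ENNReal.le_tsum (a, b))
  simp

theorem tsum_rareEnd (f : List A × List A → ℝ≥0∞) :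
    ∑' x, wt₂ P x * rareEnd o f x = coinc o P * ∑' a, wt₂ P a * f a := by
  classical
  unfold rareEnd coinc
  simp only [Finset.mul_sum, Finset.sum_mul]
  rw [Summable.tsum_finsetSum (fun _ _ => ENNReal.summable)]
  refine Finset.sum_congr rfl fun r _ => ?_
  simp only [← ENNReal.tsum_mul_left]
  rw [ENNReal.tsum_comm]
  refine tsum_congr fun a => ?_
  simp only [mul_ite, mul_zero]
  rw [tsum_eq_single (a.1 ++ [r], a.2 ++ [r])]
  · simp only [if_true, wt₂, wt_append, wt_cons, wt_nil, mul_one]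
    ring
  · intro x hx
    rw [if_neg hx]

end PairSums

/-! ### The number of matched pairs of letters other than `o` -/

section MatchedPairs

variable {A : Type*} [Fintype A] [DecidableEq A] {o : A} {P : A → ℝ≥0∞}

/-- A transition is a pair of segments followed by a common rare letter. Its mass is at most the
left side of `hm`, where 64 = 16·(2 + 2) comes from the two halves i ≤ j and j ≤ i of the sum over
the counts of `o`. As this is at most 1/2, the constant 2 solves 1 + φ/2 ≤ φ. -/
theorem sum_wt_align_le (hP : IsLaw o P) {ζ : ℝ≥0∞} (hζ : ζ ≤ 1)
    (hm : coinc o P * ((P o)⁻¹ ^ 2 * (64 * (1 - ζ)⁻¹)) ≤ 2⁻¹) (n : ℕ) (t : ℝ≥0∞)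
    (B : Finset ((Fin n → A) × (Fin n → A)))
    (hB : ∀ x ∈ B, ∃ k mn tv rl, Align o (List.ofFn x.1) (List.ofFn x.2) k mn tv rl ∧
      t ≤ 16 ^ k * 2⁻¹ ^ tv * ζ ^ mn) :
    t * ∑ x ∈ B, wt P (List.ofFn x.1) * wt P (List.ofFn x.2) ≤ 2 := by
  let F : ℕ → ℕ → ℝ≥0∞ := fun i j => 2⁻¹ ^ ((i - j) + (j - i)) * ζ ^ min i j
  let f : List A × List A → ℝ≥0∞ := fun x => F (x.1.count o) (x.2.count o)
  let W : Unit → Unit → List A × List A → ℝ≥0∞ := fun _ _ => rareEnd o fun x => 16 * f x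
  let V : Unit → List A × List A → ℝ≥0∞ := fun _ => f
  have hreach : ∀ {x y k mn tv rl}, Align o x y k mn tv rl →
      Reach W V () x y (16 ^ k * 2⁻¹ ^ tv * ζ ^ mn) := by
    intro x y k mn tv rl h
    induction h with
    | last u v =>
      refine Reach.last (le_of_eq ?_)
      simp [V, f, F, gap]
    | cons a b r hr h ih =>
      have := ih.cons (s := ()) (le_rareEnd (fun x => 16 * f x) hr a b)
      simp only [List.append_assoc, List.singleton_append] at this
      refine this.mono (le_of_eq ?_)
      simp only [f, F, gap]
      ring
  have hF1 : ∀ i j, F i j ≤ 1 := by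
    intro i j
    exact mul_le_one' (pow_le_one' (by simp) _) (pow_le_one' hζ _)
  have hV : ∀ s n n', lenSum P n n' (V s) ≤ (fun _ => 1 : Unit → ℝ≥0∞) s := by
    intro _ n n'
    have := tsum_length_mul P P n n'
    rw [hP.sum_eq, one_pow, one_pow, one_mul] at this
    rw [← this]
    unfold lenSum
    refine ENNReal.tsum_le_tsum fun x => ?_
    split_ifs
    · exact mul_le_of_le_one_right' (hF1 _ _)
    · rfl
  have hmass : ∑' a, wt₂ P a * W () () a ≤ 2⁻¹ := by
    refine le_trans (le_of_eq (tsum_rareEnd _)) (le_trans ?_ hm)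
    gcongr
    refine le_trans (hP.tsum_pair_count_le fun i j => 16 * F i j) ?_
    gcongr
    refine le_trans (tsum_tsum_le_add _) ?_
    have e1 : ∑' d : ℕ, (2⁻¹ : ℝ≥0∞) ^ d = 2 := by
      rw [ENNReal.tsum_geometric, ENNReal.one_sub_inv_two, inv_inv]
    have e2 : ∀ i d, F i (i + d) = ζ ^ i * 2⁻¹ ^ d := by
      intro i d
      simp [F, mul_comm]
    have e3 : ∀ i d, F (i + d) i = ζ ^ i * 2⁻¹ ^ d := by
      intro i d
      simp [F, mul_comm]
    simp only [e2, e3, ENNReal.tsum_mul_left, ENNReal.tsum_mul_right, e1, ENNReal.tsum_geometric]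
    refine le_of_eq ?_
    ring
  refine sum_wt_le_of_reach (W := W) (V := V) P (C := fun _ => 1) (φ := fun _ => 2) hV ?_ () n t
    B ?_
  · intro s
    simp only [Finset.univ_unique, Finset.sum_singleton]
    calc 1 + (∑' a, wt₂ P a * W s default a) * 2 ≤ 1 + 2⁻¹ * 2 := by gcongr
      _ = 2 := by
        rw [ENNReal.inv_mul_cancel (by simp) (by simp)]
        norm_num
  · intro x hx
    obtain ⟨k, mn, tv, rl, h, ht⟩ := hB x hx
    exact (hreach h).mono ht

end MatchedPairs

end LCS

namespace LCS

open List
open scoped ENNReal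

/-! ### Decomposition of optimal alignments into runs and unequal segments -/

section RunDecomposition

variable {A : Type*} [DecidableEq A] (o : A)

/-- Both lists end with `o` and have exactly two letters `o`. -/
def GroupPair (x : List A × List A) : Prop := ZeroBlock o 1 x.1 ∧ ZeroBlock o 1 x.2

open scoped Classical in
/-- The weight of the group pairs that are rich. -/
noncomputable def richW (g : ℝ≥0∞) (x : List A × List A) : ℝ≥0∞ :=
  if GroupPair o x ∧ RichPair o x.1 x.2 then g ^ 2 else 0

open scoped Classical in
/-- The weight of the group pairs that are shift pairs. -/
noncomputable def shiftW (g : ℝ≥0∞) (x : List A × List A) : ℝ≥0∞ :=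
  if GroupPair o x ∧ ShiftPair o x.1 x.2 then g ^ 2 else 0

open scoped Classical in
/-- The weight of the remaining group pairs. -/
noncomputable def plainW (g : ℝ≥0∞) (x : List A × List A) : ℝ≥0∞ :=
  if GroupPair o x ∧ ¬ RichPair o x.1 x.2 ∧ ¬ ShiftPair o x.1 x.2 then g ^ 2 else 0

/-- The weight of the end of a run of segments with equal numbers of letters `o`. -/
noncomputable def shortW (g : ℝ≥0∞) (x : List A × List A) : ℝ≥0∞ :=
  if x.1.count o = x.2.count o ∧ x.1.count o < 2 then g ^ x.1.count o else 0

/-- The weight of a segment with different numbers of letters `o`. -/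
noncomputable def unequalW (g lam tau : ℝ≥0∞) (x : List A × List A) : ℝ≥0∞ :=
  if x.1.count o = x.2.count o then 0 else
    g ^ min (x.1.count o) (x.2.count o) * lam ^ gap o x.1 x.2 * tau ^ lowRares o x.1 x.2

variable {o} in
theorem gap_eq_zero {a b : List A} (h : a.count o = b.count o) : gap o a b = 0 := by
  unfold gap
  omega

variable {o} in
theorem lowRares_eq_zero {a b : List A} (h : a.count o = b.count o) : lowRares o a b = 0 := by
  unfold lowRares
  rw [if_neg (by omega), if_neg (by omega)]

variable [Fintype A]

/-- The weights of the transitions. In the states `0` and `1` a run of equal segments is being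
read, the state being `1` if the last group pair that is not plain was a shift pair; the state is
`2` after the end of a run and `3` at the beginning and after an unequal segment. -/
noncomputable def runW (g lam tau : ℝ≥0∞) : Fin 4 → Fin 4 → List A × List A → ℝ≥0∞ :=
  ![![fun x => richW o g x + plainW o g x, shiftW o g, rareEnd o (shortW o g), fun _ => 0],
    ![richW o g, plainW o g, rareEnd o (shortW o g), fun _ => 0],
    ![fun _ => 0, fun _ => 0, fun _ => 0, rareEnd o (unequalW o g lam tau)],
    ![fun x => richW o g x + plainW o g x, shiftW o g, rareEnd o (shortW o g),
      rareEnd o (unequalW o g lam tau)]]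

/-- The weights of the last pair of lists. -/
noncomputable def runV (g lam tau del : ℝ≥0∞) : Fin 4 → List A × List A → ℝ≥0∞ :=
  ![fun x => del * shortW o g x, fun x => del * shortW o g x,
    fun x => del * unequalW o g lam tau x,
    fun x => del * (shortW o g x + unequalW o g lam tau x)]

variable {o} {g lam tau del : ℝ≥0∞}

/-- State 3 allows every move of state 0 with the same weight, and the unequal segments besides. -/
theorem decSum_run_le_fresh (N : ℕ) (x : List A × List A) :
    decSum (runW o g lam tau) (runV o g lam tau del) N 0 x ≤
      decSum (runW o g lam tau) (runV o g lam tau del) N 3 x := by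
  cases N with
  | zero => simp [decSum]
  | succ N =>
    simp only [decSum]
    refine add_le_add ?_ (Finset.sum_le_sum fun s' _ => ENNReal.tsum_le_tsum fun a =>
      ENNReal.tsum_le_tsum fun x' => ?_)
    · simp only [runV, Matrix.cons_val]
      gcongr
      exact le_self_add
    · split_ifs
      · gcongr
        fin_cases s' <;> simp [runW]
      · rfl

theorem Reach.fresh {x y : List A} {t : ℝ≥0∞}
    (h : Reach (runW o g lam tau) (runV o g lam tau del) 0 x y t) :
    Reach (runW o g lam tau) (runV o g lam tau del) 3 x y t := by
  obtain ⟨N, h⟩ := h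
  exact ⟨N, h.trans (decSum_run_le_fresh N _)⟩

/-- The run is consumed in groups of two letters `o`; `hend` takes over when fewer than two are
left. The second claim carries the memory of state 1: a shift pair `(h, h')` followed by `(k, k')`,
counted with their letters `o` only. A plain group is absorbed into `(k, k')`, a rich one erases the
memory, and another shift pair would contradict optimality, which is why state 1 has no shift
transition. -/
theorem reach_run {X Y : List A} {t : ℝ≥0∞}
    (hend : ∀ s : Fin 4, s = 0 ∨ s = 1 → ∀ a b : List A, a.count o = b.count o →
      a.count o < 2 →
      Reach (runW o g lam tau) (runV o g lam tau del) s (a ++ X) (b ++ Y) (g ^ a.count o * t))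
    (n : ℕ) : ∀ {a b : List A} {v : ℕ}, a.count o = n → Diag o a b v →
    (MaxCommon a b v → Reach (runW o g lam tau) (runV o g lam tau del) 0 (a ++ X) (b ++ Y)
        (g ^ n * t)) ∧
    (∀ h h' k k' : List A, ShiftPair o h h' → k.count o = k'.count o →
      MaxCommon (h ++ k ++ a) (h' ++ k' ++ b) (2 + k.count o + v) →
      Reach (runW o g lam tau) (runV o g lam tau del) 1 (a ++ X) (b ++ Y) (g ^ n * t)) := by
  induction n using Nat.strong_induction_on with
  | _ n ih =>
    intro a b v hn hd
    by_cases h2 : n < 2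
    · subst hn
      exact ⟨fun _ => hend 0 (Or.inl rfl) a b hd.count_eq h2,
        fun _ _ _ _ _ _ _ => hend 1 (Or.inr rfl) a b hd.count_eq h2⟩
    · obtain ⟨c, a', c', b', v₁, v₂, rfl, rfl, rfl, hc, hd', hb, hb'⟩ :=
        hd.exists_split 1 (by omega)
      have hn' : a'.count o = n - 2 := by
        rw [List.count_append, hb.count_eq] at hn
        omega
      have hpow : g ^ n * t = g ^ 2 * (g ^ (n - 2) * t) := by
        rw [← mul_assoc, ← pow_add]
        congr 2
        omega
      obtain ⟨ih0, ih1⟩ := ih (n - 2) (by omega) hn' hd'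
      have hcc := hc.commonSublist
      have hright : ∀ h h' k k' : List A, ShiftPair o h h' → k.count o = k'.count o →
          MaxCommon (h ++ k ++ (c ++ a')) (h' ++ k' ++ (c' ++ b')) (2 + k.count o + (v₁ + v₂)) →
          MaxCommon a' b' v₂ := by
        intro h h' k k' hs hk hM
        have e : 2 + k.count o + (v₁ + v₂) = (2 + k.count o + v₁) + v₂ := by omega
        rw [e, ← List.append_assoc, ← List.append_assoc] at hM
        refine hM.of_append_right (CommonSublist.append ?_ hcc)
        refine commonSublist_of_le_count o ?_ ?_
        · rw [List.count_append, hs.count_left]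
        · rw [List.count_append, hs.count_right, hk]
      simp only [List.append_assoc (as := c), List.append_assoc (as := c')]
      rw [hpow]
      by_cases hrich : RichPair o c c'
      · have hr : richW o g (c, c') = g ^ 2 := if_pos ⟨⟨hb, hb'⟩, hrich⟩
        constructor
        · intro hM
          refine (ih0 (hM.of_append_right hcc)).cons (s := 0) ?_
          simp [runW, hr]
        · intro h h' k k' hs hk hM
          refine (ih0 (hright h h' k k' hs hk (by simpa using hM))).cons (s := 1) ?_
          simp [runW, hr]
      -- A group that is not rich matches no more than its two letters `o`; this lets a plain group
      -- be absorbed into `(k, k')` without weakening the optimality hypothesis.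
      · have hv₁ : v₁ ≤ 2 := by
          by_contra hlt
          exact hrich ⟨v₁, by omega, hc⟩
        by_cases hshift : ShiftPair o c c'
        · have hr : shiftW o g (c, c') = g ^ 2 := if_pos ⟨⟨hb, hb'⟩, hshift⟩
          constructor
          · intro hM
            -- The memory begins with this shift pair and nothing after it.
            refine (ih1 c c' [] [] hshift rfl ?_).cons (s := 0) ?_
            · intro j hj
              have := hM j (by simpa using hj)
              simp
              omega
            · simp [runW, hr]
          · intro h h' k k' hs hk hM
            exfalso
            have := hM _ (by simpa using (hs.commonSublist hshift hk).append hd'.commonSublist)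
            omega
        · have hr : plainW o g (c, c') = g ^ 2 := if_pos ⟨⟨hb, hb'⟩, hrich, hshift⟩
          constructor
          · intro hM
            refine (ih0 (hM.of_append_right hcc)).cons (s := 0) ?_
            simp [runW, hr]
          · intro h h' k k' hs hk hM
            refine (ih1 h h' (k ++ c) (k' ++ c') hs ?_ ?_).cons (s := 1) ?_
            · rw [List.count_append, List.count_append, hk, hb.count_eq, hb'.count_eq]
            · intro j hj
              have := hM j (by simpa using hj)
              rw [List.count_append, hb.count_eq]
              omega
            · simp [runW, hr]

/-- Consecutive equal segments, with the rare letters between them, merge into one diagonal run, so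
their reading is postponed: the second claim carries the pending run `(a₀, b₀)` and the rare letter
`r₀` after it. An equal segment extends the run; an unequal one closes it and passes through state
2, which only an unequal segment can leave. -/
theorem Align.reach {x y : List A} {k mn tv rl : ℕ} (h : Align o x y k mn tv rl) :
    (MaxCommon x y (k + mn) → Reach (runW o g lam tau) (runV o g lam tau del) 3 x y
      (del * (g ^ mn * lam ^ tv * tau ^ rl))) ∧
    (∀ (a₀ b₀ : List A) (v₀ : ℕ) (r₀ : A), r₀ ≠ o → Diag o a₀ b₀ v₀ →
      MaxCommon (a₀ ++ r₀ :: x) (b₀ ++ r₀ :: y) (v₀ + (1 + (k + mn))) →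
      Reach (runW o g lam tau) (runV o g lam tau del) 0 (a₀ ++ r₀ :: x) (b₀ ++ r₀ :: y)
        (g ^ a₀.count o * (del * (g ^ mn * lam ^ tv * tau ^ rl)))) := by
  -- Closing the pending run: `reach_run` consumes its groups, and the remainder with fewer than two
  -- letters `o`, together with `r₀`, is the transition to state 2.
  have hflush : ∀ {x y : List A} {w : ℕ} {t : ℝ≥0∞}, CommonSublist x y w →
      Reach (runW o g lam tau) (runV o g lam tau del) 2 x y t →
      ∀ (a₀ b₀ : List A) (v₀ : ℕ) (r₀ : A), r₀ ≠ o → Diag o a₀ b₀ v₀ →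
      MaxCommon (a₀ ++ r₀ :: x) (b₀ ++ r₀ :: y) (v₀ + (1 + w)) →
      Reach (runW o g lam tau) (runV o g lam tau del) 0 (a₀ ++ r₀ :: x) (b₀ ++ r₀ :: y)
        (g ^ a₀.count o * t) := by
    intro x y w t hw ht a₀ b₀ v₀ r₀ hr hd hM
    refine (reach_run ?_ _ rfl hd).1 (hM.of_append_left ((CommonSublist.singleton r₀).append hw))
    intro s hs a b hab ha
    have h1 : g ^ a.count o ≤ runW o g lam tau s 2 (a ++ [r₀], b ++ [r₀]) := by
      have h2 := le_rareEnd (shortW o g) hr a b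
      rw [shortW, if_pos ⟨hab, ha⟩] at h2
      rcases hs with rfl | rfl <;> simpa [runW] using h2
    simpa using ht.cons h1
  induction h with
  | last u v =>
    by_cases huv : u.count o = v.count o
    · rw [gap_eq_zero huv, lowRares_eq_zero huv, huv, min_self]
      have hend : ∀ s : Fin 4, s = 0 ∨ s = 1 → ∀ a b : List A, a.count o = b.count o →
          a.count o < 2 → Reach (runW o g lam tau) (runV o g lam tau del) s (a ++ []) (b ++ [])
          (g ^ a.count o * del) := by
        intro s hs a b hab ha
        refine Reach.last ?_
        have : shortW o g (a, b) = g ^ a.count o := if_pos ⟨hab, ha⟩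
        rcases hs with rfl | rfl <;> simp [runV, this, mul_comm]
      constructor
      · intro hM
        have := (reach_run hend _ huv (diag_of_count_eq huv)).1 (by simpa [huv] using hM)
        simp only [List.append_nil] at this
        refine this.fresh.mono (le_of_eq ?_)
        ring
      · intro a₀ b₀ v₀ r₀ hr hd hM
        have hd' := hd.append ((diag_of_count_eq huv).both r₀)
        have := (reach_run hend _ rfl hd').1 (by
          intro j hj
          have := hM j hj
          omega)
        simp only [List.append_nil] at this
        refine this.mono (le_of_eq ?_)
        rw [List.count_append, List.count_cons_of_ne (by simpa using hr), huv]
        ring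
    · have hU : unequalW o g lam tau (u, v) =
          g ^ min (u.count o) (v.count o) * lam ^ gap o u v * tau ^ lowRares o u v := if_neg huv
      constructor
      · intro _
        refine Reach.last ?_
        simp only [runV, Matrix.cons_val]
        gcongr
        rw [hU]
        exact le_add_self
      · refine hflush (commonSublist_of_le_count o (by omega) (by omega)) (Reach.last ?_)
        simp only [runV, Matrix.cons_val]
        rw [hU]
  | @cons a b r hr x y k mn tv rl h ih =>
    by_cases hab : a.count o = b.count o
    · rw [gap_eq_zero hab, lowRares_eq_zero hab, zero_add, zero_add]
      have hdab := diag_of_count_eq hab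
      constructor
      · intro hM
        refine (ih.2 a b _ r hr hdab ?_).fresh.mono (le_of_eq ?_)
        · intro j hj
          have := hM j hj
          omega
        · rw [← hab, min_self]
          ring
      · intro a₀ b₀ v₀ r₀ hr₀ hd hM
        have := ih.2 (a₀ ++ r₀ :: a) (b₀ ++ r₀ :: b) _ r hr (hd.append (hdab.both r₀)) (by
          intro j hj
          have := hM j (by simpa using hj)
          omega)
        simp only [List.append_assoc, List.cons_append] at this
        refine this.mono (le_of_eq ?_)
        rw [List.count_append, List.count_cons_of_ne (by simpa using hr₀), ← hab, min_self]
        ring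
    · have hU : unequalW o g lam tau (a, b) =
          g ^ min (a.count o) (b.count o) * lam ^ gap o a b * tau ^ lowRares o a b := if_neg hab
      have hW := le_rareEnd (unequalW o g lam tau) hr a b
      rw [hU] at hW
      have hcab := commonSublist_of_le_count o (min_le_left (a.count o) (b.count o))
        (min_le_right _ _)
      have hcr := hcab.append (CommonSublist.singleton r)
      have hstep : ∀ s : Fin 4, s = 2 ∨ s = 3 →
          MaxCommon (a ++ r :: x) (b ++ r :: y)
            (k + 1 + (min (a.count o) (b.count o) + mn)) →
          Reach (runW o g lam tau) (runV o g lam tau del) s (a ++ r :: x) (b ++ r :: y)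
          (del * (g ^ (min (a.count o) (b.count o) + mn) * lam ^ (gap o a b + tv) *
            tau ^ (lowRares o a b + rl))) := by
        intro s hs hM
        have hM' : MaxCommon x y (k + mn) := by
          refine MaxCommon.of_append_right (a := a ++ [r]) (b := b ++ [r]) ?_ hcr
          intro j hj
          have := hM j (by simpa using hj)
          omega
        have := (ih.1 hM').cons (s := s) (a := a ++ [r]) (b := b ++ [r])
          (w := g ^ min (a.count o) (b.count o) * lam ^ gap o a b * tau ^ lowRares o a b)
          (by rcases hs with rfl | rfl <;> simpa [runW] using hW)
        simp only [List.append_assoc, List.singleton_append] at this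
        refine this.mono (le_of_eq ?_)
        ring
      refine ⟨hstep 3 (Or.inr rfl), fun a₀ b₀ v₀ r₀ hr₀ hd hM => ?_⟩
      have hc := (Align.cons a b r hr h).commonSublist
      refine hflush hc (hstep 2 (Or.inl rfl) ?_) a₀ b₀ v₀ r₀ hr₀ hd hM
      refine MaxCommon.of_append_right (a := a₀ ++ [r₀]) (b := b₀ ++ [r₀]) (v := v₀ + 1) ?_
        (hd.commonSublist.append (CommonSublist.singleton r₀))
      intro j hj
      have := hM j (by simpa using hj)
      omega

end RunDecomposition

end LCS

namespace LCS

open List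
open scoped ENNReal

/-! ### The masses of the transitions -/

section Masses

variable {A : Type*}

theorem tsum_swap (f : List A × List A → ℝ≥0∞) :
    ∑' x : List A × List A, f x.swap = ∑' x, f x :=
  (Equiv.prodComm (List A) (List A)).tsum_eq f

theorem tsum_mul_tsum (u v : List A → ℝ≥0∞) :
    (∑' l, u l) * ∑' l, v l = ∑' x : List A × List A, u x.1 * v x.2 := by
  rw [ENNReal.tsum_prod', ← ENNReal.tsum_mul_right]
  exact tsum_congr fun a => ENNReal.tsum_mul_left.symm

variable [DecidableEq A] {o : A} {P : A → ℝ≥0∞}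

variable (o P) in
/-- The weight `P` with the letter `o` reweighted by `α` and the other letters by `β`. -/
noncomputable def tilt (α β : ℝ≥0∞) (a : A) : ℝ≥0∞ := if a = o then P a * α else P a * β

theorem wt_tilt (α β : ℝ≥0∞) (l : List A) :
    wt (tilt o P α β) l = wt P l * α ^ l.count o * β ^ rares o l := by
  induction l with
  | nil => simp
  | cons c l ih =>
    rw [wt_cons, wt_cons, ih, rares_cons]
    by_cases h : c = o
    · subst h
      rw [List.count_cons_self, tilt, if_pos rfl, if_pos rfl]
      ring
    · rw [List.count_cons_of_ne (by simpa using h), tilt, if_neg h, if_neg h]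
      ring

/-- The minimum of the counts and the letters charged by `tau` both belong to the poorer list, so
the weight splits into a tilted weight of that list, the plain weight of the richer one, and a power
of `lam`. -/
theorem unequalW_le (g lam tau : ℝ≥0∞) (x : List A × List A) :
    wt₂ P x * unequalW o g lam tau x ≤
      wt (tilt o P g tau) x.1 * wt P x.2 *
        (if x.1.count o < x.2.count o then lam ^ (x.2.count o - x.1.count o) else 0) +
      wt (tilt o P g tau) x.2 * wt P x.1 *
        (if x.2.count o < x.1.count o then lam ^ (x.1.count o - x.2.count o) else 0) := by
  unfold unequalW wt₂ gap lowRares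
  simp only [wt_tilt]
  rcases lt_trichotomy (x.1.count o) (x.2.count o) with h | h | h
  · rw [if_neg h.ne, if_pos h, if_neg (not_lt.2 h.le), min_eq_left h.le, if_pos h,
      Nat.sub_eq_zero_of_le h.le, zero_add, mul_zero, add_zero]
    refine le_of_eq ?_
    ring
  · simp [h]
  · rw [if_neg h.ne', if_neg (not_lt.2 h.le), if_pos h, if_pos h, if_neg (not_lt.2 h.le),
      min_eq_right h.le, Nat.sub_eq_zero_of_le h.le, add_zero, mul_zero, zero_add]
    refine le_of_eq ?_
    ring

/-- The block ends with `o`, so the rare letter is not its last one. -/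
theorem ZeroBlock.split {k : ℕ} {a₁ a₂ : List A} {r : A} (hr : r ≠ o)
    (h : ZeroBlock o k (a₁ ++ r :: a₂)) : ∃ l, a₂ = l ++ [o] ∧ a₁.count o + l.count o = k := by
  obtain ⟨l, h1, h2⟩ := h
  rcases List.eq_nil_or_concat a₂ with rfl | ⟨l', c, rfl⟩
  · have := congrArg List.getLast? h1
    simp at this
    exact absurd this hr
  · have h3 : (a₁ ++ r :: l') ++ [c] = l ++ [o] := by simpa using h1
    obtain ⟨h4, h5⟩ := List.append_inj' h3 rfl
    simp only [List.cons.injEq, and_true] at h5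
    subst h5
    refine ⟨l', by simp, ?_⟩
    rw [← h2, ← h4, List.count_append, List.count_cons_of_ne (by simpa using hr)]

variable [Fintype A]

theorem sum_erase_tilt (α β : ℝ≥0∞) :
    ∑ a ∈ Finset.univ.erase o, tilt o P α β a = (∑ a ∈ Finset.univ.erase o, P a) * β := by
  rw [Finset.sum_mul]
  refine Finset.sum_congr rfl fun a ha => ?_
  rw [tilt, if_neg (Finset.ne_of_mem_erase ha)]

theorem sum_tilt (α β : ℝ≥0∞) :
    ∑ a, tilt o P α β a = P o * α + (∑ a ∈ Finset.univ.erase o, P a) * β := by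
  rw [← Finset.add_sum_erase _ _ (Finset.mem_univ o), sum_erase_tilt, tilt, if_pos rfl]

/-- A poorer list with i letters `o` has tilted mass at most (P(o)g)^i D^{-(i+1)}; the sum over i is
a geometric series, and so is the sum over the excess of the richer list. The factor 2 chooses the
poorer side. -/
theorem IsLaw.tsum_unequalW_le (hP : IsLaw o P) (g lam : ℝ≥0∞) {tau D : ℝ≥0∞} (hD : D ≠ 0)
    (hD' : D ≠ ⊤) (h : (∑ a ∈ Finset.univ.erase o, P a) * tau + D = 1) :
    ∑' x, wt₂ P x * unequalW o g lam tau x ≤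
      2 * ((P o)⁻¹ * (1 - lam)⁻¹ * (D⁻¹ * (1 - P o * g * D⁻¹)⁻¹)) := by
  have key : ∑' x : List A × List A, wt (tilt o P g tau) x.1 * wt P x.2 *
      (if x.1.count o < x.2.count o then lam ^ (x.2.count o - x.1.count o) else 0) ≤
      (P o)⁻¹ * (1 - lam)⁻¹ * (D⁻¹ * (1 - P o * g * D⁻¹)⁻¹) := by
    refine le_trans (LCS.tsum_pair_count_le o (tilt o P g tau) P hD hD' hP.ne_zero hP.ne_top
      (by rw [sum_erase_tilt, h]) hP.rare_add
      (fun i j => if i < j then lam ^ (j - i) else 0)) ?_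
    simp only [pow_mul_inv_pow_succ hP.ne_zero hP.ne_top]
    have hj : ∀ i : ℕ, ∑' j, (if i < j then lam ^ (j - i) else 0) ≤ (1 - lam)⁻¹ := by
      intro i
      refine le_trans (tsum_exists_le (fun d => i + d) (fun _ => True) (fun j => i < j)
        (fun j hj => ⟨j - i, (Nat.add_sub_of_le hj.le).symm, trivial⟩)
        (fun j => lam ^ (j - i))) ?_
      simp [ENNReal.tsum_geometric]
    have ht : tilt o P g tau o = P o * g := if_pos rfl
    calc ∑' i, ∑' j, tilt o P g tau o ^ i * D⁻¹ ^ (i + 1) * (P o)⁻¹ *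
          (if i < j then lam ^ (j - i) else 0)
        ≤ ∑' i : ℕ, tilt o P g tau o ^ i * D⁻¹ ^ (i + 1) * (P o)⁻¹ * (1 - lam)⁻¹ := by
          refine ENNReal.tsum_le_tsum fun i => ?_
          rw [ENNReal.tsum_mul_left]
          gcongr
          exact hj i
      _ = ∑' i : ℕ, (P o)⁻¹ * (1 - lam)⁻¹ * (D⁻¹ * (P o * g * D⁻¹) ^ i) := by
          refine tsum_congr fun i => ?_
          rw [ht]
          ring
      _ = _ := by
          rw [ENNReal.tsum_mul_left, ENNReal.tsum_mul_left, ENNReal.tsum_geometric]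
  refine le_trans (ENNReal.tsum_le_tsum fun x => unequalW_le g lam tau x) ?_
  rw [ENNReal.tsum_add, two_mul]
  refine add_le_add key (le_trans (le_of_eq ?_) key)
  exact tsum_swap fun x : List A × List A => wt (tilt o P g tau) x.1 * wt P x.2 *
      (if x.1.count o < x.2.count o then lam ^ (x.2.count o - x.1.count o) else 0)

/-- At fixed lengths the tilted letter weights sum to at most one, so each choice of the poorer side
contributes at most 1. -/
theorem IsLaw.lenSum_unequalW_le (hP : IsLaw o P) {g lam tau : ℝ≥0∞} (hl : lam ≤ 1)
    (h : P o * g + (∑ a ∈ Finset.univ.erase o, P a) * tau ≤ 1) (n n' : ℕ) :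
    lenSum P n n' (unequalW o g lam tau) ≤ 2 := by
  have key : ∀ n n', ∑' x : List A × List A, (if x.1.length = n ∧ x.2.length = n' then
      wt (tilt o P g tau) x.1 * wt P x.2 else 0) ≤ 1 := by
    intro n n'
    rw [tsum_length_mul, hP.sum_eq, one_pow, mul_one, sum_tilt]
    exact pow_le_one' h n
  have hF : ∀ i j : ℕ, (if i < j then lam ^ (j - i) else 0) ≤ 1 := by
    intro i j
    split_ifs
    · exact pow_le_one' hl _
    · exact zero_le
  calc lenSum P n n' (unequalW o g lam tau)
      ≤ ∑' x : List A × List A, ((if x.1.length = n ∧ x.2.length = n' then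
          wt (tilt o P g tau) x.1 * wt P x.2 else 0) +
          (if x.2.length = n' ∧ x.1.length = n then
          wt (tilt o P g tau) x.2 * wt P x.1 else 0)) := by
        unfold lenSum
        refine ENNReal.tsum_le_tsum fun x => ?_
        by_cases hx : x.1.length = n ∧ x.2.length = n'
        · rw [if_pos hx, if_pos hx, if_pos hx.symm]
          refine (unequalW_le g lam tau x).trans (add_le_add ?_ ?_) <;>
          exact mul_le_of_le_one_right' (hF _ _)
        · rw [if_neg hx]
          exact zero_le
    _ ≤ 1 + 1 := by
        rw [ENNReal.tsum_add]
        refine add_le_add (key n n') (le_trans (le_of_eq ?_) (key n' n))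
        exact tsum_swap fun x : List A × List A => if x.1.length = n' ∧ x.2.length = n then
          wt (tilt o P g tau) x.1 * wt P x.2 else 0
    _ = 2 := by norm_num

theorem IsLaw.lenSum_shortW_le (hP : IsLaw o P) {g : ℝ≥0∞} (hg : 1 ≤ g) (n n' : ℕ) :
    lenSum P n n' (shortW o g) ≤ g := by
  have := tsum_length_mul P P n n'
  rw [hP.sum_eq, one_pow, one_pow, one_mul] at this
  refine le_trans ?_ (mul_one g).le
  rw [← this, ← ENNReal.tsum_mul_left]
  unfold lenSum shortW
  refine ENNReal.tsum_le_tsum fun x => ?_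
  split_ifs with h1 h2
  · rw [mul_comm]
    unfold wt₂
    gcongr
    calc g ^ x.1.count o ≤ g ^ 1 := pow_le_pow_right₀ hg (by omega)
      _ = g := pow_one g
  · simp
  · simp

theorem IsLaw.tsum_shortW_le (hP : IsLaw o P) (g : ℝ≥0∞) :
    ∑' x, wt₂ P x * shortW o g x ≤ (P o)⁻¹ ^ 2 * (1 + g) := by
  refine le_trans (hP.tsum_pair_count_le fun i j => if i = j ∧ i < 2 then g ^ i else 0) ?_
  gcongr
  have : ∀ i : ℕ, ∑' j, (if i = j ∧ i < 2 then g ^ i else 0) = if i < 2 then g ^ i else 0 := by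
    intro i
    rw [tsum_eq_single i]
    · simp
    · intro j hj
      simp [hj.symm]
  simp only [this]
  rw [tsum_eq_sum (s := Finset.range 2)]
  · simp [Finset.sum_range_succ]
  · intro i hi
    simp only [Finset.mem_range] at hi
    simp [hi]

open scoped Classical in
-- The final `o` supplies the factor P(o) that cancels the bound 1/P(o): this is a negative binomial
-- law.
theorem IsLaw.tsum_zeroBlock_le (hP : IsLaw o P) (k : ℕ) :
    ∑' g : List A, (if ZeroBlock o k g then wt P g else 0) ≤ 1 := by
  refine le_trans (tsum_exists_le (fun l : List A => l ++ [o]) (fun l => l.count o = k)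
    (ZeroBlock o k) (fun g hg => hg) (wt P)) ?_
  calc ∑' l : List A, (if l.count o = k then wt P (l ++ [o]) else 0)
      = (∑' l : List A, if l.count o = k then wt P l else 0) * P o := by
        rw [← ENNReal.tsum_mul_right]
        refine tsum_congr fun l => ?_
        rw [wt_append, wt_cons, wt_nil, mul_one, ite_mul, zero_mul]
    _ ≤ (P o)⁻¹ * P o := by gcongr; exact hP.tsum_count_le k
    _ = 1 := ENNReal.inv_mul_cancel hP.ne_zero hP.ne_top

theorem IsLaw.tsum_groups_le (hP : IsLaw o P) :
    ∑' x, wt₂ P x * richW o 1 x + ∑' x, wt₂ P x * shiftW o 1 x + ∑' x, wt₂ P x * plainW o 1 x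
      ≤ 1 := by
  classical
  rw [← ENNReal.tsum_add, ← ENNReal.tsum_add]
  calc ∑' x, (wt₂ P x * richW o 1 x + wt₂ P x * shiftW o 1 x + wt₂ P x * plainW o 1 x)
      ≤ ∑' x : List A × List A, (if ZeroBlock o 1 x.1 then wt P x.1 else 0) *
          (if ZeroBlock o 1 x.2 then wt P x.2 else 0) := by
        refine ENNReal.tsum_le_tsum fun x => ?_
        unfold richW shiftW plainW GroupPair wt₂
        have := fun h : ShiftPair o x.1 x.2 => h.not_richPair
        by_cases h1 : ZeroBlock o 1 x.1 <;> by_cases h2 : ZeroBlock o 1 x.2 <;>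
        by_cases h3 : RichPair o x.1 x.2 <;> by_cases h4 : ShiftPair o x.1 x.2 <;>
        simp [h1, h2, h3, h4]
        exact absurd h3 (this h4)
    _ = (∑' a : List A, if ZeroBlock o 1 a then wt P a else 0) *
          ∑' b : List A, if ZeroBlock o 1 b then wt P b else 0 := by
        rw [tsum_mul_tsum]
    _ ≤ 1 * 1 := by gcongr <;> exact hP.tsum_zeroBlock_le 1
    _ = 1 := one_mul 1

theorem coinc_mul_le_tsum_shiftW : coinc o P * P o ^ 4 ≤ ∑' x, wt₂ P x * shiftW o 1 x := by
  let f : A → List A × List A := fun r => ([r, o, o], [o, r, o])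
  have hf : Function.Injective f := by
    intro r s h
    simpa [f] using h
  refine le_trans ?_ (ENNReal.tsum_comp_le_tsum_of_injective hf _)
  rw [tsum_fintype]
  refine le_trans ?_ (Finset.sum_le_sum_of_subset (Finset.erase_subset o Finset.univ))
  unfold coinc
  rw [Finset.sum_mul]
  refine Finset.sum_le_sum fun r hr => ?_
  have hr := Finset.ne_of_mem_erase hr
  have : shiftW o 1 (f r) = 1 := by
    unfold shiftW
    rw [if_pos, one_pow]
    exact ⟨⟨⟨[r, o], rfl, by simp [hr]⟩, ⟨[o, r], rfl, by simp [hr]⟩⟩, r, hr, rfl, rfl⟩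
  rw [this]
  simp only [f, wt₂, wt_cons, wt_nil]
  refine le_of_eq ?_
  ring

/-- A rich pair has a rare match preceded by i letters `o` on both sides, with i = 0 or 1 since the
group ends with `o`. Each i contributes the coincidence probability times P(o)² for the final
letters and P(o)⁻⁴ for the four free pieces. -/
theorem IsLaw.tsum_richW_le (hP : IsLaw o P) :
    ∑' x, wt₂ P x * richW o 1 x ≤ 2 * (coinc o P * (P o)⁻¹ ^ 2) := by
  classical
  let f : (Fin 2 × A) × (List A × List A) × (List A × List A) → List A × List A :=
    fun i => (i.2.1.1 ++ i.1.2 :: (i.2.2.1 ++ [o]), i.2.1.2 ++ i.1.2 :: (i.2.2.2 ++ [o]))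
  let p : (Fin 2 × A) × (List A × List A) × (List A × List A) → Prop := fun i =>
    i.1.2 ≠ o ∧ (i.2.1.1.count o = i.1.1 ∧ i.2.1.2.count o = i.1.1) ∧
      (i.2.2.1.count o = 1 - i.1.1 ∧ i.2.2.2.count o = 1 - i.1.1)
  calc ∑' x, wt₂ P x * richW o 1 x
      = ∑' x, (if GroupPair o x ∧ RichPair o x.1 x.2 then wt₂ P x else 0) := by
        refine tsum_congr fun x => ?_
        simp [richW]
    _ ≤ ∑' i, if p i then wt₂ P (f i) else 0 := by
        refine tsum_exists_le f p _ ?_ _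
        rintro ⟨x, y⟩ ⟨⟨hx, hy⟩, v, hv, hd⟩
        obtain ⟨a₁, a₂, b₁, b₂, r, hr, h1, h2, h3⟩ :=
          hd.exists_rare_match (by rw [hx.count_eq]; exact hv)
        dsimp only at h1 h2 hx hy
        subst h1 h2
        obtain ⟨l, rfl, hl⟩ := hx.split hr
        obtain ⟨l', rfl, hl'⟩ := hy.split hr
        refine ⟨((⟨a₁.count o, by omega⟩, r), (a₁, b₁), (l, l')), rfl, hr, ⟨rfl, h3.symm⟩, ?_, ?_⟩
        · dsimp only; omega
        · dsimp only; omega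
    _ = ∑' i : Fin 2 × A, (if i.2 ≠ o then P i.2 ^ 2 * P o ^ 2 else 0) *
          (((∑' l : List A, if l.count o = i.1 then wt P l else 0) *
            (∑' l : List A, if l.count o = i.1 then wt P l else 0)) *
          ((∑' l : List A, if l.count o = 1 - i.1 then wt P l else 0) *
            (∑' l : List A, if l.count o = 1 - i.1 then wt P l else 0))) := by
        rw [ENNReal.tsum_prod']
        refine tsum_congr fun i => ?_
        rw [tsum_mul_tsum, tsum_mul_tsum, ← ENNReal.tsum_mul_right, ← ENNReal.tsum_mul_left, ENNReal.tsum_prod']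
        refine tsum_congr fun a => ?_
        rw [← ENNReal.tsum_mul_left, ← ENNReal.tsum_mul_left]
        refine tsum_congr fun b => ?_
        by_cases h1 : i.2 = o
        · simp [p, h1]
        by_cases h2 : a.1.count o = i.1
        swap
        · simp [p, h2]
        by_cases h3 : a.2.count o = i.1
        swap
        · simp [p, h3]
        by_cases h4 : b.1.count o = 1 - i.1
        swap
        · simp [p, h4]
        by_cases h5 : b.2.count o = 1 - i.1
        swap
        · simp [p, h5]
        have hp : p (i, a, b) := ⟨h1, ⟨h2, h3⟩, h4, h5⟩
        rw [if_pos hp, if_pos h1, if_pos h2, if_pos h3, if_pos h4, if_pos h5]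
        simp only [f, wt₂, wt_append, wt_cons, wt_nil]
        ring
    _ ≤ ∑' i : Fin 2 × A, (if i.2 ≠ o then P i.2 ^ 2 * P o ^ 2 else 0) *
          (((P o)⁻¹ * (P o)⁻¹) * ((P o)⁻¹ * (P o)⁻¹)) := by
        refine ENNReal.tsum_le_tsum fun i => ?_
        gcongr <;> exact hP.tsum_count_le _
    _ = 2 * ((coinc o P * P o ^ 2) * (((P o)⁻¹ * (P o)⁻¹) * ((P o)⁻¹ * (P o)⁻¹))) := by
        rw [ENNReal.tsum_mul_right, ENNReal.tsum_prod', tsum_fintype, Fin.sum_univ_two, two_mul,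
          ← add_mul]
        congr 1
        have : ∑' b : A, (if b ≠ o then P b ^ 2 * P o ^ 2 else 0) = coinc o P * P o ^ 2 := by
          unfold coinc
          rw [tsum_fintype, Finset.sum_mul, ← Finset.sum_filter]
          refine Finset.sum_congr ?_ fun _ _ => rfl
          ext b
          simp
        dsimp only
        rw [this]
    _ = 2 * (coinc o P * (P o)⁻¹ ^ 2) * (P o * (P o)⁻¹) ^ 2 := by ring
    _ = _ := by rw [ENNReal.mul_inv_cancel hP.ne_zero hP.ne_top, one_pow, mul_one]

end Masses

end LCS

namespace LCS

open List
open scoped ENNReal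

/-! ### The letters in unequal segments of optimal alignments -/

section UnequalSegments

theorem ofReal_add_sum_mul_le {ι : Type*} [Fintype ι] {c d : ℝ} {N φ : ι → ℝ} {M : ι → ℝ≥0∞}
    (hc : 0 ≤ c) (hM : ∀ i, M i ≤ ENNReal.ofReal (N i)) (hN : ∀ i, 0 ≤ N i) (hφ : ∀ i, 0 ≤ φ i)
    (h : c + ∑ i, N i * φ i ≤ d) :
    ENNReal.ofReal c + ∑ i, M i * ENNReal.ofReal (φ i) ≤ ENNReal.ofReal d := by
  refine le_trans ?_ (ENNReal.ofReal_le_ofReal h)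
  rw [ENNReal.ofReal_add hc (Finset.sum_nonneg fun i _ => mul_nonneg (hN i) (hφ i)),
    ENNReal.ofReal_sum_of_nonneg fun i _ => mul_nonneg (hN i) (hφ i)]
  gcongr with i
  rw [ENNReal.ofReal_mul (hN i)]
  gcongr
  exact hM i

variable {A : Type*} {P : A → ℝ≥0∞}

theorem lenSum_const_mul (n n' : ℕ) (del : ℝ≥0∞) (f : List A × List A → ℝ≥0∞) :
    lenSum P n n' (fun x => del * f x) = del * lenSum P n n' f := by
  unfold lenSum
  rw [← ENNReal.tsum_mul_left]
  refine tsum_congr fun x => ?_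
  split_ifs
  · ring
  · simp

theorem lenSum_add (n n' : ℕ) (f f' : List A × List A → ℝ≥0∞) :
    lenSum P n n' (fun x => f x + f' x) = lenSum P n n' f + lenSum P n n' f' := by
  unfold lenSum
  rw [← ENNReal.tsum_add]
  refine tsum_congr fun x => ?_
  split_ifs
  · ring
  · simp

theorem tsum_groupW (g : ℝ≥0∞) (f : ℝ≥0∞ → List A × List A → ℝ≥0∞)
    (hf : ∀ x, f g x = g ^ 2 * f 1 x) :
    ∑' x, wt₂ P x * f g x = g ^ 2 * ∑' x, wt₂ P x * f 1 x := by
  rw [← ENNReal.tsum_mul_left]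
  exact tsum_congr fun x => by rw [hf x]; ring

variable [Fintype A] [DecidableEq A] {o : A}

/-- Let R ≤ 2.01ρ and S ≥ 0.99ρ be the rich and shift masses. State 1 loses S and returns to state 0
only through R. With potentials 1 and 3/4, one group leads to at most 1 − S/4 from state 0 and 3/4 +
R/4 − 3S/4 from state 1: both lose a multiple of ρ. That loss pays for the reward g² ≤ 1 + ρ/40, the
ends of runs and the final weights. -/
theorem sum_wt_optimal_align_le (hP : IsLaw o P) {q ρ : ℝ} (hq : P o = ENNReal.ofReal q)
    (hq1 : 999 / 1000 ≤ q) (hρ : coinc o P = ENNReal.ofReal ρ) (hρ0 : 0 < ρ)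
    (hρ1 : ρ ≤ 1 / 1000) {lam tau : ℝ≥0∞} (hlam : lam ≤ 1)
    (htau : P o * ENNReal.ofReal (1 + ρ / 100) + (∑ a ∈ Finset.univ.erase o, P a) * tau ≤ 1)
    (hU : ∑' x, wt₂ P x * rareEnd o (unequalW o (ENNReal.ofReal (1 + ρ / 100)) lam tau) x ≤
      ENNReal.ofReal (1 / 200)) (n : ℕ) (t : ℝ≥0∞)
    (B : Finset ((Fin n → A) × (Fin n → A)))
    (hB : ∀ x ∈ B, ∃ k mn tv rl, Align o (List.ofFn x.1) (List.ofFn x.2) k mn tv rl ∧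
      MaxCommon (List.ofFn x.1) (List.ofFn x.2) (k + mn) ∧
      t ≤ ENNReal.ofReal (1 + ρ / 100) ^ mn * lam ^ tv * tau ^ rl) :
    ENNReal.ofReal (ρ / 400) * t * ∑ x ∈ B, wt P (List.ofFn x.1) * wt P (List.ofFn x.2) ≤ 2 := by
  set g := ENNReal.ofReal (1 + ρ / 100) with hg
  -- The last pair has total weight up to 2 + 2, which must fit into a loss of order ρ per step;
  -- scaling it by ρ/400 costs a prefactor 400/ρ in the final bound.
  set del := ENNReal.ofReal (ρ / 400) with hdel
  have hg1 : 1 ≤ g := by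
    rw [hg, ← ENNReal.ofReal_one]
    exact ENNReal.ofReal_le_ofReal (by linarith)
  have hg2 : g ≤ 2 := by
    rw [hg, ← ENNReal.ofReal_ofNat]
    exact ENNReal.ofReal_le_ofReal (by linarith)
  have hC : ∀ s n n', lenSum P n n' (runV o g lam tau del s) ≤
      (fun _ => ENNReal.ofReal (ρ / 100) : Fin 4 → ℝ≥0∞) s := by
    intro s n n'
    have h1 := (hP.lenSum_shortW_le hg1 n n').trans hg2
    have h2 := hP.lenSum_unequalW_le hlam htau n n'
    have h4 : ENNReal.ofReal (ρ / 100) = del * (2 + 2) := by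
      rw [hdel, show (2 + 2 : ℝ≥0∞) = ENNReal.ofReal 4 by norm_num,
        ← ENNReal.ofReal_mul (by positivity)]
      congr 1
      ring
    rw [h4]
    fin_cases s <;> simp only [runV, Fin.zero_eta, Fin.mk_one, Fin.reduceFinMk, Matrix.cons_val] <;>
      rw [lenSum_const_mul] <;> gcongr
    · exact h1.trans le_self_add
    · exact h1.trans le_self_add
    · exact h2.trans le_self_add
    · rw [lenSum_add]
      exact add_le_add h1 h2
  have hsum := hP.tsum_groups_le
  have hrich := hP.tsum_richW_le
  have hshift := coinc_mul_le_tsum_shiftW (o := o) (P := P)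
  have hshort : ∑' x, wt₂ P x * rareEnd o (shortW o g) x ≤ ENNReal.ofReal (21 / 10 * ρ) := by
    rw [tsum_rareEnd]
    refine le_trans (mul_le_mul_right (hP.tsum_shortW_le g) _) ?_
    rw [hρ, hq, hg, ← ENNReal.ofReal_one, ← ENNReal.ofReal_add (by norm_num) (by positivity),
      ← ENNReal.ofReal_inv_of_pos (by linarith), ← ENNReal.ofReal_pow (by positivity),
      ← ENNReal.ofReal_mul (by positivity), ← ENNReal.ofReal_mul hρ0.le]
    refine ENNReal.ofReal_le_ofReal ?_
    have : q⁻¹ ≤ 1001 / 1000 + 1 / 10000 := by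
      rw [inv_le_comm₀ (by linarith) (by norm_num)]
      norm_num
      linarith
    have h0 : 0 < q⁻¹ := by positivity
    have h2 : q⁻¹ ^ 2 ≤ 1003 / 1000 := by nlinarith
    have h3 : q⁻¹ ^ 2 * (1 + (1 + ρ / 100)) ≤ 21 / 10 := by nlinarith
    nlinarith
  set mR := ∑' x, wt₂ P x * richW o 1 x with hmR
  set mS := ∑' x, wt₂ P x * shiftW o 1 x with hmS
  set mP := ∑' x, wt₂ P x * plainW o 1 x with hmP
  have fR : mR ≠ ⊤ := ne_top_of_le_ne_top ENNReal.one_ne_top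
    (le_trans (le_trans le_self_add le_self_add) hsum)
  have fS : mS ≠ ⊤ := ne_top_of_le_ne_top ENNReal.one_ne_top
    (le_trans (le_trans le_add_self le_self_add) hsum)
  have fP : mP ≠ ⊤ := ne_top_of_le_ne_top ENNReal.one_ne_top (le_trans le_add_self hsum)
  obtain ⟨r, hr0, hr⟩ : ∃ r : ℝ, 0 ≤ r ∧ mR = ENNReal.ofReal r :=
    ⟨mR.toReal, ENNReal.toReal_nonneg, (ENNReal.ofReal_toReal fR).symm⟩
  obtain ⟨s, hs0, hs⟩ : ∃ r : ℝ, 0 ≤ r ∧ mS = ENNReal.ofReal r :=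
    ⟨mS.toReal, ENNReal.toReal_nonneg, (ENNReal.ofReal_toReal fS).symm⟩
  obtain ⟨l, hl0, hl⟩ : ∃ r : ℝ, 0 ≤ r ∧ mP = ENNReal.ofReal r :=
    ⟨mP.toReal, ENNReal.toReal_nonneg, (ENNReal.ofReal_toReal fP).symm⟩
  have e1 : r + s + l ≤ 1 := by
    rw [hr, hs, hl, ← ENNReal.ofReal_add hr0 hs0, ← ENNReal.ofReal_add (by positivity) hl0,
      ENNReal.ofReal_le_one] at hsum
    exact hsum
  have e2 : r ≤ 201 / 100 * ρ := by
    rw [hr, hρ, hq, ← ENNReal.ofReal_inv_of_pos (by linarith), ← ENNReal.ofReal_pow (by positivity),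
      ← ENNReal.ofReal_mul hρ0.le, ← ENNReal.ofReal_ofNat, ← ENNReal.ofReal_mul (by norm_num),
      ENNReal.ofReal_le_ofReal_iff (by positivity)] at hrich
    refine hrich.trans ?_
    have : q⁻¹ ≤ 1001 / 1000 + 1 / 10000 := by
      rw [inv_le_comm₀ (by linarith) (by norm_num)]
      norm_num
      linarith
    have h0 : 0 < q⁻¹ := by positivity
    have h2 : q⁻¹ ^ 2 ≤ 1003 / 1000 := by nlinarith
    nlinarith
  have e3 : 99 / 100 * ρ ≤ s := by
    rw [hs, hρ, hq, ← ENNReal.ofReal_pow (by linarith), ← ENNReal.ofReal_mul hρ0.le,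
      ENNReal.ofReal_le_ofReal_iff hs0] at hshift
    refine le_trans ?_ hshift
    have h2 : (998 / 1000 : ℝ) ≤ q ^ 2 := by nlinarith
    have h4 : (99 / 100 : ℝ) ≤ q ^ 4 := by nlinarith
    nlinarith
  have hG : g ^ 2 = ENNReal.ofReal ((1 + ρ / 100) ^ 2) := by
    rw [hg, ENNReal.ofReal_pow (by positivity)]
  obtain ⟨G, hGdef⟩ : ∃ G : ℝ, G = (1 + ρ / 100) ^ 2 := ⟨_, rfl⟩
  have hG0 : 0 ≤ G := by rw [hGdef]; positivity
  have hG1 : G ≤ 1 + ρ / 40 := by rw [hGdef]; nlinarith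
  rw [← hGdef] at hG
  have wR : ∑' x, wt₂ P x * richW o g x ≤ ENNReal.ofReal (G * r) := by
    rw [tsum_groupW g (richW o) (by intro x; simp [richW]), hG, ← hmR, hr,
      ← ENNReal.ofReal_mul hG0]
  have wS : ∑' x, wt₂ P x * shiftW o g x ≤ ENNReal.ofReal (G * s) := by
    rw [tsum_groupW g (shiftW o) (by intro x; simp [shiftW]), hG, ← hmS, hs,
      ← ENNReal.ofReal_mul hG0]
  have wP : ∑' x, wt₂ P x * plainW o g x ≤ ENNReal.ofReal (G * l) := by
    rw [tsum_groupW g (plainW o) (by intro x; simp [plainW]), hG, ← hmP, hl,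
      ← ENNReal.ofReal_mul hG0]
  have wRP : ∑' x, wt₂ P x * (richW o g x + plainW o g x) ≤ ENNReal.ofReal (G * r + G * l) := by
    simp only [mul_add, ENNReal.tsum_add]
    rw [ENNReal.ofReal_add (by positivity) (by positivity)]
    exact add_le_add wR wP
  -- State 2 is left only with mass 1/200 towards potential 2, so 1/50 suffices there, and ending a
  -- run then costs only (21/10)ρ/50.
  let φ : Fin 4 → ℝ := ![1, 3 / 4, 1 / 50, 2]
  have hφ0 : ∀ i, 0 ≤ φ i := by
    intro i
    fin_cases i <;> (simp [φ]; try norm_num)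
  let N : Fin 4 → Fin 4 → ℝ := ![![G * r + G * l, G * s, 21 / 10 * ρ, 0],
    ![G * r, G * l, 21 / 10 * ρ, 0], ![0, 0, 0, 1 / 200],
    ![G * r + G * l, G * s, 21 / 10 * ρ, 1 / 200]]
  have hN : ∀ i j, 0 ≤ N i j := by
    intro i j
    fin_cases i <;> fin_cases j <;>
      simp only [N, Fin.zero_eta, Fin.mk_one, Fin.reduceFinMk, Matrix.cons_val] <;> positivity
  have hMN : ∀ i j, ∑' a, wt₂ P a * runW o g lam tau i j a ≤ ENNReal.ofReal (N i j) := by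
    intro i j
    fin_cases i <;> fin_cases j <;>
      simp only [runW, N, Fin.zero_eta, Fin.mk_one, Fin.reduceFinMk, Matrix.cons_val, mul_zero,
        tsum_zero, zero_le] <;>
      assumption
  have key := sum_wt_le_of_reach (W := runW o g lam tau) (V := runV o g lam tau del) P
    (C := fun _ => ENNReal.ofReal (ρ / 100)) (φ := fun i => ENNReal.ofReal (φ i)) hC ?_ 3 n
    (del * t) B ?_
  · simpa [φ] using key
  · intro i
    refine ofReal_add_sum_mul_le (by positivity) (hMN i) (hN i) hφ0 ?_
    fin_cases i <;> rw [Fin.sum_univ_four] <;>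
      simp only [φ, N, Fin.zero_eta, Fin.mk_one, Fin.reduceFinMk, Matrix.cons_val]
    · have : G * (r + l + s * (3 / 4)) ≤ (1 + ρ / 40) * (1 - s / 4) := by
        refine mul_le_mul hG1 (by linarith) (by positivity) (by positivity)
      nlinarith
    · have : G * (r + l * (3 / 4)) ≤ (1 + ρ / 40) * (3 / 4 - ρ / 5) := by
        refine mul_le_mul hG1 (by linarith) (by positivity) (by positivity)
      nlinarith
    · linarith
    · have : G * (r + l + s * (3 / 4)) ≤ (1 + ρ / 40) * 1 := by
        refine mul_le_mul hG1 (by linarith) (by positivity) (by positivity)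
      nlinarith
  · intro x hx
    obtain ⟨k, mn, tv, rl, ha, hM, ht⟩ := hB x hx
    exact (ha.reach.1 hM).mono (mul_le_mul_right ht _)

end UnequalSegments

end LCS

namespace LCS

open scoped ENNReal

/-! ### Words and lists -/

section Words

variable {A : Type*} {n : ℕ}

theorem exists_sublist_iff_hasCommonSubseq (x y : Fin n → A) (k : ℕ) :
    HasCommonSubseq x y k ↔
      ∃ l : List A, l.Sublist (List.ofFn x) ∧ l.Sublist (List.ofFn y) ∧ l.length = k := by
  constructor
  · rintro ⟨i, j, hi, hj, hij⟩
    have key : ∀ (z : Fin n → A) (i : Fin k → Fin n), StrictMono i →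
        (List.ofFn fun s => z (i s)).Sublist (List.ofFn z) := by
      intro z i hi
      rw [List.sublist_iff_exists_fin_orderEmbedding_get_eq]
      refine ⟨((Fin.castOrderIso (by simp)).toOrderEmbedding.trans
        (OrderEmbedding.ofStrictMono i hi)).trans
        (Fin.castOrderIso (by simp)).toOrderEmbedding, fun ix => ?_⟩
      simp
      rfl
    refine ⟨List.ofFn fun s => x (i s), key x i hi, ?_, by simp⟩
    rw [show (fun s => x (i s)) = fun s => y (j s) from funext hij]
    exact key y j hj
  · rintro ⟨l, hx, hy, rfl⟩
    rw [List.sublist_iff_exists_fin_orderEmbedding_get_eq] at hx hy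
    obtain ⟨f, hf⟩ := hx
    obtain ⟨g, hg⟩ := hy
    refine ⟨fun s => Fin.cast (by simp) (f s), fun s => Fin.cast (by simp) (g s),
      fun a b hab => ?_, fun a b hab => ?_, fun s => ?_⟩
    · exact f.strictMono hab
    · exact g.strictMono hab
    · have h1 := hf s
      have h2 := hg s
      rw [List.get_ofFn] at h1 h2
      exact h1.symm.trans h2

theorem commonSublist_ofFn_iff (x y : Fin n → A) (k : ℕ) :
    CommonSublist (List.ofFn x) (List.ofFn y) k ↔ HasCommonSubseq x y k := by
  rw [exists_sublist_iff_hasCommonSubseq]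
  constructor
  · rintro ⟨l, h1, h2, h3⟩
    exact ⟨l.take k, (l.take_sublist k).trans h1, (l.take_sublist k).trans h2, by simp [h3]⟩
  · rintro ⟨l, h1, h2, h3⟩
    exact ⟨l, h1, h2, h3.ge⟩

theorem bddAbove_hasCommonSubseq (x y : Fin n → A) : BddAbove {k | HasCommonSubseq x y k} := by
  refine ⟨n, fun k hk => ?_⟩
  obtain ⟨i, _, hi, _, _⟩ := hk
  simpa using Fintype.card_le_of_injective i hi.injective

theorem commonSublist_lc (x y : Fin n → A) :
    CommonSublist (List.ofFn x) (List.ofFn y) (lc x y) := by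
  rw [commonSublist_ofFn_iff]
  refine Nat.sSup_mem (s := {k | HasCommonSubseq x y k}) ⟨0, ?_⟩ (bddAbove_hasCommonSubseq x y)
  exact ⟨Fin.elim0, Fin.elim0, fun a => a.elim0, fun a => a.elim0, fun a => a.elim0⟩

theorem maxCommon_lc (x y : Fin n → A) : MaxCommon (List.ofFn x) (List.ofFn y) (lc x y) := by
  intro k hk
  rw [commonSublist_ofFn_iff] at hk
  exact le_csSup (bddAbove_hasCommonSubseq x y) hk

theorem ofFn_update [DecidableEq (Fin n)] (x : Fin n → A) (i : Fin n) (a : A) :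
    List.ofFn (Function.update x i a) = (List.ofFn x).set i a := by
  refine List.ext_getElem (by simp) fun j h1 h2 => ?_
  simp only [List.getElem_ofFn, List.getElem_set, Function.update_apply]
  refine if_congr ?_ rfl rfl
  rw [Fin.ext_iff, eq_comm]

theorem natCount_eq_card (p : ℕ → Prop) [DecidablePred p] (n : ℕ) :
    Nat.count p n = (Finset.univ.filter fun i : Fin n => p i).card := by
  rw [Nat.count_eq_card_filter_range, ← Finset.card_map Fin.valEmbedding]
  congr 1
  ext i
  simp only [Finset.mem_filter, Finset.mem_range, Finset.mem_map, Finset.mem_univ, true_and,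
    Fin.valEmbedding_apply]
  constructor
  · rintro ⟨h1, h2⟩
    exact ⟨⟨i, h1⟩, h2, rfl⟩
  · rintro ⟨j, h, rfl⟩
    exact ⟨j.2, h⟩

theorem card_filter_sum (p : Fin n ⊕ Fin n → Prop) [DecidablePred p] :
    (Finset.univ.filter p).card = (Finset.univ.filter fun i => p (Sum.inl i)).card +
      (Finset.univ.filter fun i => p (Sum.inr i)).card := by
  simp only [Finset.card_filter, Fintype.sum_sum_type]

theorem getD_ofFn (a : A) (x : Fin n → A) (i : Fin n) : (List.ofFn x).getD i a = x i := by
  rw [List.getD_eq_getElem _ _ (by simp)]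
  simp

variable [DecidableEq A] (a : A)

open scoped Classical in
theorem card_otherPositions (x y : Fin n → A) :
    (Finset.univ.filter fun s => s ∈ otherPositions a x y).card =
      rares a (List.ofFn x) + rares a (List.ofFn y) := by
  rw [card_filter_sum, ← count_getD_ne, ← count_getD_ne, natCount_eq_card, natCount_eq_card]
  have : ∀ z : Fin n → A, (Finset.univ.filter fun i : Fin (List.ofFn z).length =>
      (List.ofFn z).getD i a ≠ a).card = (Finset.univ.filter fun i : Fin n => z i ≠ a).card := by
    intro z
    rw [← natCount_eq_card fun i => (List.ofFn z).getD i a ≠ a, List.length_ofFn,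
      natCount_eq_card]
    simp only [getD_ofFn]
  rw [this, this]
  congr! 3

open scoped Classical in
-- `incCount` says only that the optimum grows; by `CommonSublist.set_succ` it grows by exactly one.
theorem card_inc_ge (x y : Fin n → A) :
    incCount a (List.ofFn x) (List.ofFn y) (lc x y) +
      incCount a (List.ofFn y) (List.ofFn x) (lc x y) ≤
      (Finset.univ.filter fun s => s ∈ otherPositions a x y ∧
        (lc (changeAt a x y s).1 (changeAt a x y s).2 : ℤ) - lc x y = 1).card := by
  rw [card_filter_sum]
  unfold incCount
  rw [List.length_ofFn, List.length_ofFn, natCount_eq_card, natCount_eq_card]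
  refine Nat.add_le_add (Finset.card_le_card fun i hi => ?_) (Finset.card_le_card fun i hi => ?_)
  · simp only [Finset.mem_filter, Finset.mem_univ, true_and, getD_ofFn] at hi ⊢
    refine ⟨hi.1, ?_⟩
    rw [← ofFn_update] at hi
    have h1 := maxCommon_lc _ _ _ hi.2
    have h2 := commonSublist_lc (Function.update x i a) y
    rw [ofFn_update] at h2
    have h3 := maxCommon_lc x y _
      (CommonSublist.set_succ (k := lc (Function.update x i a) y - 1) (h2.mono (by omega)))
    simp only [changeAt]
    omega
  · simp only [Finset.mem_filter, Finset.mem_univ, true_and, getD_ofFn] at hi ⊢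
    refine ⟨hi.1, ?_⟩
    rw [← ofFn_update] at hi
    have h1 := maxCommon_lc _ _ _ hi.2.symm
    have h2 := (commonSublist_lc x (Function.update y i a)).symm
    rw [ofFn_update] at h2
    have h3 := maxCommon_lc x y _
      (CommonSublist.set_succ (k := lc x (Function.update y i a) - 1) (h2.mono (by omega))).symm
    simp only [changeAt]
    omega

open scoped Classical in
theorem card_dec_le (x y : Fin n → A) :
    (Finset.univ.filter fun s => s ∈ otherPositions a x y ∧
        (lc (changeAt a x y s).1 (changeAt a x y s).2 : ℤ) - lc x y = -1).card ≤
      decCount a (List.ofFn x) (List.ofFn y) (lc x y) +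
      decCount a (List.ofFn y) (List.ofFn x) (lc x y) := by
  rw [card_filter_sum]
  unfold decCount
  rw [List.length_ofFn, List.length_ofFn, natCount_eq_card, natCount_eq_card]
  refine Nat.add_le_add (Finset.card_le_card fun i hi => ?_) (Finset.card_le_card fun i hi => ?_)
  · rw [Finset.mem_filter] at hi ⊢
    simp only [Finset.mem_univ, true_and, getD_ofFn, changeAt] at hi ⊢
    refine ⟨hi.1, fun h => ?_⟩
    rw [← ofFn_update] at h
    have h1 := maxCommon_lc _ _ _ h
    omega
  · rw [Finset.mem_filter] at hi ⊢
    simp only [Finset.mem_univ, true_and, getD_ofFn, changeAt] at hi ⊢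
    refine ⟨hi.1, fun h => ?_⟩
    rw [← ofFn_update] at h
    have h1 := maxCommon_lc _ _ _ h.symm
    omega

end Words

/-! ### The conditional law of the picked position -/

section Pick

instance sum_discreteMeasurableSpace (n : ℕ) : DiscreteMeasurableSpace (Fin n ⊕ Fin n) :=
  ⟨fun _ => measurableSet_sum_iff.2 ⟨.of_discrete, .of_discrete⟩⟩

variable {Ω : Type*} [MeasurableSpace Ω] {μ : Measure Ω} {m n : ℕ} {X Y : ℕ → Ω → Fin m}

theorem measurable_word (hX : ∀ i, Measurable (X i)) (n : ℕ) : Measurable (word X n) :=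
  measurable_pi_lambda _ fun i => hX i

theorem measurableSet_wordsEq (hX : ∀ i, Measurable (X i)) (hY : ∀ i, Measurable (Y i))
    (x y : Fin n → Fin m) : MeasurableSet (wordsEq X Y x y) :=
  (measurable_word hX n (measurableSet_singleton x)).inter
    (measurable_word hY n (measurableSet_singleton y))

open scoped Classical in
-- Given the words, the difference is a function of the picked position, whose conditional law is
-- uniform.
theorem cond_changedLC_sub_LC [IsProbabilityMeasure μ] (hX : ∀ i, Measurable (X i))
    (hY : ∀ i, Measurable (Y i)) (a : Fin m) {J : Ω → Fin n ⊕ Fin n} (hJm : Measurable J)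
    (hJ : IsUniformPick μ a X Y J) {x y : Fin n → Fin m} (h : μ (wordsEq X Y x y) ≠ 0)
    (hne : (otherPositions a x y).Nonempty) (d : ℤ) :
    (μ[|wordsEq X Y x y]).real {ω | (changedLC a X Y J ω : ℤ) - LC n X Y ω = d} =
      ((Finset.univ.filter fun s => s ∈ otherPositions a x y ∧
        (lc (changeAt a x y s).1 (changeAt a x y s).2 : ℤ) - lc x y = d).card : ℝ) /
      (Finset.univ.filter fun s => s ∈ otherPositions a x y).card := by
  have hE := measurableSet_wordsEq hX hY x y
  set T : Set (Fin n ⊕ Fin n) :=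
    {s | (lc (changeAt a x y s).1 (changeAt a x y s).2 : ℤ) - lc x y = d} with hT
  have h1 : (μ[|wordsEq X Y x y]).real {ω | (changedLC a X Y J ω : ℤ) - LC n X Y ω = d} =
      (μ[|wordsEq X Y x y]).real (J ⁻¹' T) := by
    refine measureReal_congr ?_
    filter_upwards [ae_cond_mem (μ := μ) hE] with ω hω
    obtain ⟨h1, h2⟩ := hω
    apply propext
    change ((changedLC a X Y J ω : ℤ) - LC n X Y ω = d) ↔ _
    simp only [changedLC, LC, h1, h2, hT]
    rfl
  rw [h1, measureReal_def, ← Measure.map_apply hJm .of_discrete, hJ x y h hne]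
  have hS : otherPositions a x y =
      ((Finset.univ.filter fun s => s ∈ otherPositions a x y : Finset _) : Set _) := by simp
  have hT' : T = ((Finset.univ.filter fun s => s ∈ T : Finset _) : Set _) := by simp
  rw [hT']
  conv_lhs => rw [hS]
  rw [uniformOn_apply_finset, ENNReal.toReal_div, ENNReal.toReal_natCast, ENNReal.toReal_natCast,
    ← Finset.filter_and]
  rfl

end Pick

end LCS

namespace LCS

open scoped ENNReal

/-! ### The law of the words -/

section Law

theorem count_ofFn_word {Ω : Type*} {m n : ℕ} (X : ℕ → Ω → Fin m) (o : Fin m) (ω : Ω) :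
    ((List.ofFn (word X n ω)).count o : ℝ) =
      ∑ i ∈ Finset.range n, ({o} : Set (Fin m)).indicator (fun _ => (1 : ℝ)) (X i ω) := by
  induction n with
  | zero => simp
  | succ n ih =>
    rw [Finset.sum_range_succ, ← ih, List.ofFn_succ', List.concat_eq_append, List.count_append,
      Nat.cast_add]
    congr 1
    by_cases h : X n ω = o <;> simp [word, h]

variable {Ω : Type*} [MeasurableSpace Ω] {μ : Measure Ω} {m : ℕ} {X Y : ℕ → Ω → Fin m}
  {P : Fin m → ℝ≥0∞}

theorem measure_word_eq (hX : iIndepFun X μ) (hlaw : ∀ i k, μ {ω | X i ω = k} = P k) {n : ℕ}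
    (x : Fin n → Fin m) : μ {ω | word X n ω = x} = wt P (List.ofFn x) := by
  let sets : ℕ → Set (Fin m) := fun i => if h : i < n then {x ⟨i, h⟩} else Set.univ
  have h := hX.measure_inter_preimage_eq_mul (Finset.range n) (sets := sets)
    (fun i _ => .of_discrete)
  have h1 : {ω | word X n ω = x} = ⋂ i ∈ Finset.range n, X i ⁻¹' sets i := by
    ext ω
    simp only [Set.mem_ofPred_eq, Set.mem_iInter, Finset.mem_range, Set.mem_preimage]
    constructor
    · rintro rfl i hi
      simp [sets, hi, word]
    · intro h
      funext i
      simpa [sets, word] using h i i.2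
  rw [h1, h, wt, List.map_ofFn, List.prod_ofFn, ← Fin.prod_univ_eq_prod_range
    (fun i => μ (X i ⁻¹' sets i))]
  refine Finset.prod_congr rfl fun i _ => ?_
  simp only [sets, i.2, dif_pos, Function.comp_apply]
  exact hlaw i (x i)

theorem measure_wordsEq (hX : iIndepFun X μ) (hY : iIndepFun Y μ)
    (hXY : IndepFun (fun ω i => X i ω) (fun ω i => Y i ω) μ)
    (hXlaw : ∀ i k, μ {ω | X i ω = k} = P k) (hYlaw : ∀ i k, μ {ω | Y i ω = k} = P k) {n : ℕ}
    (x y : Fin n → Fin m) :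
    μ (wordsEq X Y x y) = wt P (List.ofFn x) * wt P (List.ofFn y) := by
  let f : (ℕ → Fin m) → Fin n → Fin m := fun w i => w i
  have hf : Measurable f := measurable_pi_lambda _ fun i => measurable_pi_apply _
  have h := (hXY.comp hf hf).measure_inter_preimage_eq_mul {x} {y}
    (measurableSet_singleton x) (measurableSet_singleton y)
  rw [← measure_word_eq hX hXlaw x, ← measure_word_eq hY hYlaw y]
  exact h

theorem measure_words_mem_le (hX : iIndepFun X μ) (hY : iIndepFun Y μ)
    (hXY : IndepFun (fun ω i => X i ω) (fun ω i => Y i ω) μ)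
    (hXlaw : ∀ i k, μ {ω | X i ω = k} = P k) (hYlaw : ∀ i k, μ {ω | Y i ω = k} = P k) {n : ℕ}
    (B : Finset ((Fin n → Fin m) × (Fin n → Fin m))) :
    μ {ω | (word X n ω, word Y n ω) ∈ B} ≤
      ∑ x ∈ B, wt P (List.ofFn x.1) * wt P (List.ofFn x.2) := by
  have : {ω | (word X n ω, word Y n ω) ∈ B} ⊆ ⋃ x ∈ B, wordsEq X Y x.1 x.2 := by
    intro ω hω
    simp only [Set.mem_iUnion]
    exact ⟨_, hω, rfl, rfl⟩
  refine (measure_mono this).trans ((measure_biUnion_finset_le _ _).trans ?_)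
  exact Finset.sum_le_sum fun x _ => (measure_wordsEq hX hY hXY hXlaw hYlaw x.1 x.2).le

/-- Hoeffding's inequality for the number of letters `o`. -/
theorem measure_abs_count_sub_ge_le [IsProbabilityMeasure μ] (hXm : ∀ i, Measurable (X i))
    (hX : iIndepFun X μ) (o : Fin m) {q : ℝ} (hlaw : ∀ i, μ.real {ω | X i ω = o} = q) {n : ℕ}
    (hn : 1 ≤ n) {ε : ℝ} (hε : 0 ≤ ε) :
    μ.real {ω | n * ε ≤ |((List.ofFn (word X n ω)).count o : ℝ) - n * q|} ≤
      2 * Real.exp (-(2 * n * ε ^ 2)) := by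
  let f : Fin m → ℝ := ({o} : Set (Fin m)).indicator fun _ => (1 : ℝ)
  have hf : Measurable f := measurable_of_finite f
  have hmean : ∀ i, ∫ ω, f (X i ω) ∂μ = q := by
    intro i
    rw [← hlaw i]
    have : (fun ω => f (X i ω)) = Set.indicator {ω | X i ω = o} fun _ => (1 : ℝ) := by
      ext ω
      by_cases h : X i ω = o <;> simp [f, h]
    rw [this]
    exact integral_indicator_one (hXm i (measurableSet_singleton o))
  have hsub : ∀ i, HasSubgaussianMGF (fun ω => f (X i ω) - q) ((‖(1 : ℝ) - 0‖₊ / 2) ^ 2) μ := by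
    intro i
    have := hasSubgaussianMGF_of_mem_Icc (μ := μ) (X := fun ω => f (X i ω)) (a := 0) (b := 1)
      (hf.comp (hXm i)).aemeasurable (by
        refine Filter.Eventually.of_forall fun ω => ?_
        by_cases h : X i ω = o <;> simp [f, h])
    rwa [hmean i] at this
  -- The sub-Gaussian parameter of a variable in [0, 1], which gives the exponent 2nε².
  have hc : (((‖(1 : ℝ) - 0‖₊ / 2) ^ 2 : NNReal) : ℝ) = 1 / 4 := by
    simp
    norm_num
  have hind := hX.comp (fun _ c => f c - q) (fun _ => hf.sub_const q)
  have hind' := hX.comp (fun _ c => -(f c - q)) (fun _ => (hf.sub_const q).neg)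
  have hn0 : (0 : ℝ) < n := by exact_mod_cast hn
  have hexp : ∀ c : ℝ, c = 1 / 4 → -(n * ε) ^ 2 / (2 * n * c) = -(2 * n * ε ^ 2) := by
    intro c hc
    rw [hc]
    field_simp
    ring
  have h1 := HasSubgaussianMGF.measure_sum_range_ge_le_of_iIndepFun hind (n := n)
    (fun i _ => hsub i) (ε := n * ε) (by positivity)
  have h2 := HasSubgaussianMGF.measure_sum_range_ge_le_of_iIndepFun hind' (n := n)
    (fun i _ => (hsub i).neg) (ε := n * ε) (by positivity)
  rw [hexp _ hc] at h1 h2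
  have hsum : ∀ ω, ((List.ofFn (word X n ω)).count o : ℝ) - n * q =
      ∑ i ∈ Finset.range n, (f (X i ω) - q) := by
    intro ω
    rw [count_ofFn_word, Finset.sum_sub_distrib]
    simp [f]
  calc μ.real {ω | n * ε ≤ |((List.ofFn (word X n ω)).count o : ℝ) - n * q|}
      ≤ μ.real ({ω | n * ε ≤ ∑ i ∈ Finset.range n, (f (X i ω) - q)} ∪
          {ω | n * ε ≤ ∑ i ∈ Finset.range n, -(f (X i ω) - q)}) := by
        refine measureReal_mono fun ω hω => ?_
        simp only [Set.mem_ofPred_eq, hsum, Set.mem_union, Finset.sum_neg_distrib] at hω ⊢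
        exact le_abs.1 hω
    _ ≤ _ := by
        refine (measureReal_union_le _ _).trans ?_
        rw [two_mul]
        exact add_le_add h1 h2

end Law

/-! ### Estimates of the weights of alignments -/

section Estimates

/-- This bound and the next two follow from log x ≥ 1 − 1/x. -/
theorem exp_neg_two_mul_le {v : ℝ} (hv : v ≤ 1 / 2) (hv0 : 0 ≤ v) :
    Real.exp (-(2 * v)) ≤ 1 - v := by
  rw [← Real.le_log_iff_exp_le (by linarith)]
  refine le_trans ?_ (Real.one_sub_inv_le_log_of_pos (by linarith))
  have : (1 - v)⁻¹ ≤ 1 + 2 * v := by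
    rw [inv_le_iff_one_le_mul₀ (by linarith)]
    nlinarith
  linarith

theorem exp_neg_le_one_sub {u : ℝ} (hu0 : 0 ≤ u) (hu : u ≤ 1 / 1000) :
    Real.exp (-(1002 / 1000 * u)) ≤ 1 - u := by
  rw [← Real.le_log_iff_exp_le (by linarith)]
  refine le_trans ?_ (Real.one_sub_inv_le_log_of_pos (by linarith))
  have : (1 - u)⁻¹ ≤ 1 + 1002 / 1000 * u := by
    rw [inv_le_iff_one_le_mul₀ (by linarith)]
    nlinarith
  linarith

theorem exp_le_one_add {u : ℝ} (hu0 : 0 ≤ u) (hu : u ≤ 1 / 1000) :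
    Real.exp (99 / 100 * u) ≤ 1 + u := by
  rw [← Real.le_log_iff_exp_le (by linarith)]
  refine le_trans ?_ (Real.one_sub_inv_le_log_of_pos (by linarith))
  have : (1 + u)⁻¹ ≤ 1 - 99 / 100 * u := by
    rw [inv_le_iff_one_le_mul₀ (by linarith)]
    nlinarith
  linarith

/-- In the exponent, 16^k 2^{-2k} = 4^k gives at least 400 log 2 > 277 times nρ; the last factor
costs at most 200.4 nρ, and the rest of `tv` at most nρ log 2. -/
theorem exp_le_weight_of_many_matches {ρ : ℝ} {n k mn tv : ℕ} (hρ0 : 0 < ρ)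
    (hρ1 : ρ ≤ 1 / 10 ^ 6) (hmn : mn ≤ n) (htv : (tv : ℝ) ≤ 2 * k + n * ρ)
    (hk : 200 * (n * ρ) ≤ k) :
    Real.exp (n * ρ) ≤ 16 ^ k * 2⁻¹ ^ tv * (1 - 200 * ρ) ^ mn := by
  have e16 : (16 : ℝ) = Real.exp (4 * Real.log 2) := by
    rw [show 4 * Real.log 2 = Real.log (2 ^ 4) by rw [Real.log_pow]; norm_num,
      Real.exp_log (by norm_num)]
    norm_num
  have e2 : (2⁻¹ : ℝ) = Real.exp (-Real.log 2) := by
    rw [Real.exp_neg, Real.exp_log (by norm_num)]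
  have e1 := exp_neg_le_one_sub (u := 200 * ρ) (by positivity) (by linarith)
  have hmn' : (mn : ℝ) ≤ n := by exact_mod_cast hmn
  calc Real.exp (n * ρ) ≤ Real.exp (k * (4 * Real.log 2) + tv * (-Real.log 2) +
          mn * (-(1002 / 1000 * (200 * ρ)))) := by
        refine Real.exp_le_exp.2 ?_
        have hl := Real.log_two_gt_d9
        have h1 : (tv : ℝ) * Real.log 2 ≤ (2 * k + n * ρ) * Real.log 2 := by gcongr
        have h2 : 200 * (n * ρ) * (2 * Real.log 2) ≤ k * (2 * Real.log 2) := by gcongr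
        have h3 : (mn : ℝ) * ρ ≤ n * ρ := by gcongr
        have h4 : (0 : ℝ) ≤ n * ρ := by positivity
        have h5 : (n * ρ) * 0.6931 ≤ (n * ρ) * Real.log 2 := by
          gcongr
          linarith
        nlinarith
    _ = 16 ^ k * 2⁻¹ ^ tv * Real.exp (-(1002 / 1000 * (200 * ρ))) ^ mn := by
        rw [Real.exp_add, Real.exp_add, Real.exp_nat_mul, Real.exp_nat_mul, Real.exp_nat_mul,
          ← e16, ← e2]
    _ ≤ _ := by gcongr

/-- In units of nρ, the reward is at least 0.0089 and the losses are at most 401/2¹⁹ + 1/1000 <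
0.002, which leaves more than 1/200. -/
theorem exp_le_weight_of_few_rares {ρ σ : ℝ} {n mn tv rl : ℕ} (hρ0 : 0 < ρ)
    (hρ1 : ρ ≤ 1 / 10 ^ 6) (hmn : 9 / 10 * (n : ℝ) ≤ mn) (htv : (tv : ℝ) ≤ 401 * (n * ρ))
    (hσ0 : 0 ≤ σ) (hσ1 : σ ≤ 1 / 2) (hrl : σ * rl ≤ n * ρ / 2000) :
    Real.exp (n * ρ / 200) ≤ (1 + ρ / 100) ^ mn * (1 - 1 / 2 ^ 20) ^ tv * (1 - σ) ^ rl := by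
  have e1 := exp_le_one_add (u := ρ / 100) (by positivity) (by linarith)
  have e2 := exp_neg_two_mul_le (v := 1 / 2 ^ 20) (by norm_num) (by norm_num)
  have e3 := exp_neg_two_mul_le hσ1 hσ0
  calc Real.exp (n * ρ / 200) ≤ Real.exp (mn * (99 / 100 * (ρ / 100)) +
          tv * (-(2 * (1 / 2 ^ 20))) + rl * (-(2 * σ))) := by
        refine Real.exp_le_exp.2 ?_
        have h1 : 9 / 10 * (n : ℝ) * (99 / 100 * (ρ / 100)) ≤ mn * (99 / 100 * (ρ / 100)) := by
          gcongr
        have h4 : (0 : ℝ) ≤ n * ρ := by positivity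
        nlinarith
    _ = Real.exp (99 / 100 * (ρ / 100)) ^ mn * Real.exp (-(2 * (1 / 2 ^ 20))) ^ tv *
          Real.exp (-(2 * σ)) ^ rl := by
        rw [Real.exp_add, Real.exp_add, Real.exp_nat_mul, Real.exp_nat_mul, Real.exp_nat_mul]
    _ ≤ _ := by
        have : (0 : ℝ) ≤ 1 - 1 / 2 ^ 20 := by norm_num
        gcongr

end Estimates

end LCS

namespace LCS

open scoped ENNReal

/-! ### Typical words -/

section Typical

variable {A : Type*} [DecidableEq A] {o : A}

/-- For words with typical numbers of letters `o`, either the changes of one letter behave as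
desired, or there is an alignment of large weight. -/
theorem inc_dec_or_exists_align {x y : List A} {n v : ℕ} (hx : x.length = n) (hy : y.length = n)
    (hv : CommonSublist x y v) (hM : MaxCommon x y v) {q s ρ p κ η : ℝ} (hqs : q + s = 1)
    (hp0 : 0 < p) (hp : p ≤ 1 / 2 ^ 70) (hρ0 : p ^ 2 ≤ ρ) (hρ : ρ ≤ p * s) (hs : s ≤ 1 / 2 ^ 70)
    (hκ : κ ≤ 1 / 2 ^ 70) (hη : 400 * p ≤ 199 / 100 * η)
    (hcx : |(x.count o : ℝ) - n * q| ≤ n * (p ^ 2 / 2))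
    (hcy : |(y.count o : ℝ) - n * q| ≤ n * (p ^ 2 / 2)) :
    (κ * (rares o x + rares o y : ℝ) ≤ (incCount o x y v + incCount o y x v : ℝ) ∧
      (decCount o x y v + decCount o y x v : ℝ) ≤ η * (rares o x + rares o y : ℝ)) ∨
    (∃ k mn tv rl, Align o x y k mn tv rl ∧
      Real.exp (n * ρ) ≤ 16 ^ k * 2⁻¹ ^ tv * (1 - 200 * ρ) ^ mn) ∨
    (∃ k mn tv rl, Align o x y k mn tv rl ∧ MaxCommon x y (k + mn) ∧
      Real.exp (n * ρ / 200) ≤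
        (1 + ρ / 100) ^ mn * (1 - 1 / 2 ^ 20) ^ tv * (1 - 2 ^ 30 * ρ / s) ^ rl) := by
  obtain ⟨k, mn, tv, rl, ha, rfl⟩ := exists_align_of_maxCommon o hv hM
  have hρpos : 0 < ρ := lt_of_lt_of_le (by positivity) hρ0
  have hs0 : 0 < s := by
    by_contra h
    have : p * s ≤ 0 := mul_nonpos_of_nonneg_of_nonpos hp0.le (not_lt.1 h)
    linarith
  have hps : p * s ≤ 1 / 2 ^ 70 * s := by gcongr
  have hρ1 : ρ ≤ 1 / 10 ^ 6 := by
    have : 1 / 2 ^ 70 * s ≤ 1 / 2 ^ 70 * (1 / 2 ^ 70) := by gcongr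
    norm_num at this ⊢
    linarith
  have hcount := ha.count_add_count
  have hcountR : (x.count o : ℝ) + y.count o = 2 * mn + tv := by exact_mod_cast hcount
  have hrx : (x.count o : ℝ) + rares o x = n := by
    exact_mod_cast (count_add_rares o x).trans hx
  have hry : (y.count o : ℝ) + rares o y = n := by
    exact_mod_cast (count_add_rares o y).trans hy
  have hmin := hM _ (commonSublist_of_le_count o (min_le_left (x.count o) (y.count o))
    (min_le_right _ _))
  obtain ⟨hx1, hx2⟩ := abs_le.1 hcx
  obtain ⟨hy1, hy2⟩ := abs_le.1 hcy
  have hn0 : (0 : ℝ) ≤ n := by positivity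
  have hnp : n * p ^ 2 ≤ n * ρ := by gcongr
  have hnρ : n * ρ ≤ n * (1 / 2 ^ 70 * s) := by gcongr; linarith
  have hns : (n : ℝ) * s ≤ n * (1 / 2 ^ 70) := by gcongr
  have hnq : (n : ℝ) * q + n * s = n := by rw [← mul_add, hqs, mul_one]
  have hmin' : (x.count o : ℝ) ≤ k + mn ∨ (y.count o : ℝ) ≤ k + mn := by
    rcases le_total (x.count o) (y.count o) with h | h
    · left
      rw [min_eq_left h] at hmin
      exact_mod_cast hmin
    · right
      rw [min_eq_right h] at hmin
      exact_mod_cast hmin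
  -- Optimality gives k + mn ≥ min(`x.count o`, `y.count o`), and the sum of the counts is 2mn + tv;
  -- so tv exceeds 2k by at most the difference of the counts, which is at most np² ≤ nρ.
  have htv : (tv : ℝ) ≤ 2 * k + n * ρ := by
    rcases hmin' with h | h <;> linarith
  have hN1 : 199 / 100 * (n * s) ≤ (rares o x : ℝ) + rares o y := by
    norm_num at hnρ
    linarith
  have hN2 : (rares o x : ℝ) + rares o y ≤ 21 / 10 * (n * s) := by
    norm_num at hnρ
    linarith
  by_cases hk : 200 * (n * ρ) ≤ k
  · right; left
    refine ⟨k, mn, tv, rl, ha, exp_le_weight_of_many_matches hρpos hρ1 ?_ htv hk⟩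
    have h1 := List.count_le_length (a := o) (l := x)
    have h2 := List.count_le_length (a := o) (l := y)
    omega
  · rw [not_le] at hk
    by_cases hrl : κ * (rares o x + rares o y : ℝ) ≤ rl
    · left
      constructor
      · exact hrl.trans (by exact_mod_cast ha.le_incCount)
      · obtain ⟨h1, h2⟩ := ha.decCount_le
        have h1' : (decCount o x y (k + mn) : ℝ) ≤ k := by exact_mod_cast h1
        have h2' : (decCount o y x (k + mn) : ℝ) ≤ k := by exact_mod_cast h2
        have hη0 : 0 ≤ η := by linarith
        have h3 : η * (199 / 100 * (n * s)) ≤ η * (rares o x + rares o y : ℝ) := by gcongr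
        -- Here 2k < 400nρ ≤ 400p·ns, to be compared with η times the number of rare letters.
        have h4 : 400 * p * (n * s) ≤ 199 / 100 * η * (n * s) := by gcongr
        have h5 : (n : ℝ) * ρ ≤ n * (p * s) := by gcongr
        linarith
    · right; right
      rw [not_le] at hrl
      refine ⟨k, mn, tv, rl, ha, hM, exp_le_weight_of_few_rares hρpos hρ1 ?_ ?_ ?_ ?_ ?_⟩
      · norm_num at hnρ hns
        rcases hmin' with h | h <;> linarith
      · linarith
      · positivity
      · rw [div_le_iff₀ hs0]
        have : (2 : ℝ) ^ 30 * ρ ≤ 2 ^ 30 * (1 / 2 ^ 70 * s) := by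
          gcongr
          linarith
        norm_num at this ⊢
        linarith
      · have h1 : 2 ^ 30 * ρ / s * rl ≤ 2 ^ 30 * ρ / s * (1 / 2 ^ 70 * (21 / 10 * (n * s))) := by
          gcongr
          refine hrl.le.trans ?_
          gcongr
        have h2 : 2 ^ 30 * ρ / s * (1 / 2 ^ 70 * (21 / 10 * (n * s))) =
            (2 ^ 30 / 2 ^ 70 * (21 / 10)) * (n * ρ) := by
          field_simp
        rw [h2] at h1
        have h4 : (0 : ℝ) ≤ n * ρ := by positivity
        norm_num at h1 ⊢
        linarith

end Typical

/-! ### Atypical words are improbable -/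

section Improbable

variable {Ω : Type*} [MeasurableSpace Ω] {μ : Measure Ω} {m : ℕ}
  {X Y : ℕ → Ω → Fin m} {P : Fin m → ℝ≥0∞} {o : Fin m}

theorem toReal_le_of_mul_le {a : ℝ≥0∞} {t c : ℝ} (ht : 0 < t) (hc : 0 ≤ c)
    (h : ENNReal.ofReal t * a ≤ ENNReal.ofReal c) : a.toReal ≤ c / t := by
  have h1 : a ≤ ENNReal.ofReal (c / t) := by
    rw [ENNReal.ofReal_div_of_pos ht, ENNReal.le_div_iff_mul_le (by simp [ht]) (by simp), mul_comm]
    exact h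
  exact ENNReal.toReal_le_of_le_ofReal (by positivity) h1

open scoped Classical in
theorem measure_many_matches_le (hX : iIndepFun X μ) (hY : iIndepFun Y μ)
    (hXY : IndepFun (fun ω i => X i ω) (fun ω i => Y i ω) μ)
    (hXlaw : ∀ i k, μ {ω | X i ω = k} = P k) (hYlaw : ∀ i k, μ {ω | Y i ω = k} = P k)
    (hP : IsLaw o P) {q ρ : ℝ} (hq : P o = ENNReal.ofReal q) (hq1 : 999 / 1000 ≤ q)
    (hρ : coinc o P = ENNReal.ofReal ρ) (hρ0 : 0 < ρ) (hρ1 : ρ ≤ 1 / 1000) (n : ℕ) :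
    μ.real {ω | ∃ k mn tv rl, Align o (List.ofFn (word X n ω)) (List.ofFn (word Y n ω)) k mn tv rl
      ∧ Real.exp (n * ρ) ≤ 16 ^ k * 2⁻¹ ^ tv * (1 - 200 * ρ) ^ mn} ≤ 2 * Real.exp (-(n * ρ)) := by
  set B : Finset ((Fin n → Fin m) × (Fin n → Fin m)) := Finset.univ.filter fun x =>
    ∃ k mn tv rl, Align o (List.ofFn x.1) (List.ofFn x.2) k mn tv rl
      ∧ Real.exp (n * ρ) ≤ 16 ^ k * 2⁻¹ ^ tv * (1 - 200 * ρ) ^ mn with hB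
  have h1 := measure_words_mem_le hX hY hXY hXlaw hYlaw B
  have h2 := sum_wt_align_le hP (ζ := ENNReal.ofReal (1 - 200 * ρ)) (by
      rw [ENNReal.ofReal_le_one]; linarith) (by
      rw [hρ, hq, ← ENNReal.ofReal_one, ← ENNReal.ofReal_sub _ (by linarith),
        ← ENNReal.ofReal_inv_of_pos (by linarith), ← ENNReal.ofReal_inv_of_pos (by linarith),
        ← ENNReal.ofReal_pow (by positivity),
        show (64 : ℝ≥0∞) = ENNReal.ofReal 64 by norm_num,
        show (2⁻¹ : ℝ≥0∞) = ENNReal.ofReal 2⁻¹ by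
          rw [ENNReal.ofReal_inv_of_pos (by norm_num)]; norm_num,
        ← ENNReal.ofReal_mul (by norm_num), ← ENNReal.ofReal_mul (by positivity),
        ← ENNReal.ofReal_mul hρ0.le]
      refine ENNReal.ofReal_le_ofReal ?_
      have : q⁻¹ ≤ 11 / 10 := by
        rw [inv_le_comm₀ (by linarith) (by norm_num)]
        linarith
      have h0 : 0 < q⁻¹ := by
        have : 0 < q := by linarith
        positivity
      have h2 : q⁻¹ ^ 2 ≤ 121 / 100 := by nlinarith
      -- The choice ζ = 1 − 200ρ makes ρ cancel, leaving 64/200 up to the factor q⁻².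
      have h3 : ρ * (q⁻¹ ^ 2 * (64 * (1 - (1 - 200 * ρ))⁻¹)) = q⁻¹ ^ 2 * (64 / 200) := by
        rw [sub_sub_cancel]
        field_simp
      rw [h3]
      linarith) n (ENNReal.ofReal (Real.exp (n * ρ))) B (by
      intro x hx
      obtain ⟨k, mn, tv, rl, ha, hw⟩ := (Finset.mem_filter.1 hx).2
      refine ⟨k, mn, tv, rl, ha, ?_⟩
      refine (ENNReal.ofReal_le_ofReal hw).trans (le_of_eq ?_)
      rw [ENNReal.ofReal_mul (by positivity), ENNReal.ofReal_mul (by positivity),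
        ENNReal.ofReal_pow (by norm_num), ENNReal.ofReal_pow (by norm_num),
        ENNReal.ofReal_pow (by linarith), ENNReal.ofReal_inv_of_pos (by norm_num)]
      norm_num)
  have h3 : {ω | (word X n ω, word Y n ω) ∈ B} = {ω | ∃ k mn tv rl,
      Align o (List.ofFn (word X n ω)) (List.ofFn (word Y n ω)) k mn tv rl
      ∧ Real.exp (n * ρ) ≤ 16 ^ k * 2⁻¹ ^ tv * (1 - 200 * ρ) ^ mn} := by
    ext ω
    simp [hB]
  rw [h3] at h1
  have h4 := (mul_le_mul_right h1 (ENNReal.ofReal (Real.exp (n * ρ)))).trans h2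
  rw [show (2 : ℝ≥0∞) = ENNReal.ofReal 2 by norm_num] at h4
  refine (toReal_le_of_mul_le (Real.exp_pos _) (by norm_num) h4).trans (le_of_eq ?_)
  rw [Real.exp_neg, div_eq_mul_inv]

/-- The value of `tau` makes D = 1 − s·tau equal to q + 2³⁰ρ, so D − qg ≥ (2³⁰ − 1)ρ. This ρ cancels
the coincidence probability, and about 2.2·2²⁰/2³⁰ < 1/200 is left: the 2²⁰ of `lam` is affordable
because of the 2³⁰ in `tau`. -/
theorem IsLaw.tsum_rareEnd_unequalW_le (hP : IsLaw o P) {q s ρ : ℝ}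
    (hq : P o = ENNReal.ofReal q) (hs : ∑ a ∈ Finset.univ.erase o, P a = ENNReal.ofReal s)
    (hqs : q + s = 1) (hq1 : 999 / 1000 ≤ q) (hs0 : 0 < s) (hρ : coinc o P = ENNReal.ofReal ρ)
    (hρ0 : 0 < ρ) (hρs : 2 ^ 30 * ρ ≤ s) :
    ∑' x, wt₂ P x * rareEnd o (unequalW o (ENNReal.ofReal (1 + ρ / 100))
      (ENNReal.ofReal (1 - 1 / 2 ^ 20)) (ENNReal.ofReal (1 - 2 ^ 30 * ρ / s))) x ≤
      ENNReal.ofReal (1 / 200) := by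
  have hq0 : 0 < q := by linarith
  have hD0 : 0 < q + 2 ^ 30 * ρ := by positivity
  have hσ : 2 ^ 30 * ρ / s ≤ 1 := (div_le_one hs0).2 hρs
  have hq2 : q ≤ 1 := by linarith
  have hqρ : q * ρ ≤ 1 * ρ := by gcongr
  have hlt : q * (1 + ρ / 100) < q + 2 ^ 30 * ρ := by
    norm_num
    linarith
  have hdiv : q * (1 + ρ / 100) * (q + 2 ^ 30 * ρ)⁻¹ < 1 := by
    rw [← div_eq_mul_inv, div_lt_one hD0]
    exact hlt
  rw [tsum_rareEnd]
  refine le_trans (mul_le_mul_right (hP.tsum_unequalW_le _ _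
    (D := ENNReal.ofReal (q + 2 ^ 30 * ρ)) (by simpa using hD0) (by simp) ?_) _) ?_
  · rw [hs, ← ENNReal.ofReal_mul hs0.le, ← ENNReal.ofReal_add
      (mul_nonneg hs0.le (by linarith)) hD0.le, ← ENNReal.ofReal_one]
    congr 1
    field_simp
    linarith
  · rw [hρ, hq, ← ENNReal.ofReal_inv_of_pos hD0, ← ENNReal.ofReal_inv_of_pos hq0,
      ← ENNReal.ofReal_mul hq0.le, ← ENNReal.ofReal_mul (by positivity), ← ENNReal.ofReal_one,
      ← ENNReal.ofReal_sub _ (by norm_num), ← ENNReal.ofReal_sub _ (by positivity),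
      ← ENNReal.ofReal_inv_of_pos (by norm_num), ← ENNReal.ofReal_inv_of_pos (by linarith),
      ← ENNReal.ofReal_mul (by positivity), ← ENNReal.ofReal_mul (by positivity),
      ← ENNReal.ofReal_mul (by norm_num; positivity),
      show (2 : ℝ≥0∞) = ENNReal.ofReal 2 by norm_num, ← ENNReal.ofReal_mul (by norm_num),
      ← ENNReal.ofReal_mul hρ0.le]
    refine ENNReal.ofReal_le_ofReal ?_
    have h1 : (q + 2 ^ 30 * ρ)⁻¹ * (1 - q * (1 + ρ / 100) * (q + 2 ^ 30 * ρ)⁻¹)⁻¹ =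
        (q + 2 ^ 30 * ρ - q * (1 + ρ / 100))⁻¹ := by
      rw [← mul_inv]
      congr 1
      field_simp
    have h2 : (q + 2 ^ 30 * ρ - q * (1 + ρ / 100))⁻¹ ≤ ((2 ^ 30 - 1) * ρ)⁻¹ := by
      refine inv_anti₀ (by norm_num; positivity) ?_
      linarith
    have h3 : q⁻¹ ≤ 11 / 10 := by
      rw [inv_le_comm₀ (by linarith) (by norm_num)]
      linarith
    have hq' : 0 < q⁻¹ := by positivity
    rw [h1]
    calc ρ * (2 * (q⁻¹ * (1 - (1 - 1 / 2 ^ 20))⁻¹ * (q + 2 ^ 30 * ρ - q * (1 + ρ / 100))⁻¹))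
        ≤ ρ * (2 * (11 / 10 * (1 - (1 - 1 / 2 ^ 20))⁻¹ * ((2 ^ 30 - 1) * ρ)⁻¹)) := by
          gcongr
      _ = 2 * (11 / 10) * (1 - (1 - 1 / 2 ^ 20))⁻¹ * (2 ^ 30 - 1)⁻¹ := by
          field_simp
      _ ≤ 1 / 200 := by norm_num

open scoped Classical in
theorem measure_few_rares_le (hX : iIndepFun X μ) (hY : iIndepFun Y μ)
    (hXY : IndepFun (fun ω i => X i ω) (fun ω i => Y i ω) μ)
    (hXlaw : ∀ i k, μ {ω | X i ω = k} = P k) (hYlaw : ∀ i k, μ {ω | Y i ω = k} = P k)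
    (hP : IsLaw o P) {q s ρ : ℝ} (hq : P o = ENNReal.ofReal q)
    (hs : ∑ a ∈ Finset.univ.erase o, P a = ENNReal.ofReal s)
    (hqs : q + s = 1) (hq1 : 999 / 1000 ≤ q) (hs0 : 0 < s)
    (hρ : coinc o P = ENNReal.ofReal ρ) (hρ0 : 0 < ρ) (hρ1 : ρ ≤ 1 / 1000)
    (hρs : 2 ^ 30 * ρ ≤ s) (n : ℕ) :
    μ.real {ω | ∃ k mn tv rl, Align o (List.ofFn (word X n ω)) (List.ofFn (word Y n ω)) k mn tv rl
      ∧ MaxCommon (List.ofFn (word X n ω)) (List.ofFn (word Y n ω)) (k + mn) ∧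
      Real.exp (n * ρ / 200) ≤
        (1 + ρ / 100) ^ mn * (1 - 1 / 2 ^ 20) ^ tv * (1 - 2 ^ 30 * ρ / s) ^ rl} ≤
      800 / ρ * Real.exp (-(n * ρ / 200)) := by
  have hσ : 2 ^ 30 * ρ / s ≤ 1 := (div_le_one hs0).2 hρs
  set B : Finset ((Fin n → Fin m) × (Fin n → Fin m)) := Finset.univ.filter fun x =>
    ∃ k mn tv rl, Align o (List.ofFn x.1) (List.ofFn x.2) k mn tv rl
      ∧ MaxCommon (List.ofFn x.1) (List.ofFn x.2) (k + mn) ∧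
      Real.exp (n * ρ / 200) ≤
        (1 + ρ / 100) ^ mn * (1 - 1 / 2 ^ 20) ^ tv * (1 - 2 ^ 30 * ρ / s) ^ rl with hB
  have h1 := measure_words_mem_le hX hY hXY hXlaw hYlaw B
  have h2 := sum_wt_optimal_align_le hP hq hq1 hρ hρ0 hρ1 (by
      rw [ENNReal.ofReal_le_one]; norm_num) (by
      rw [hs, hq, ← ENNReal.ofReal_mul (by linarith), ← ENNReal.ofReal_mul hs0.le,
        ← ENNReal.ofReal_add (mul_nonneg (by linarith) (by positivity))
          (mul_nonneg hs0.le (by linarith)), ENNReal.ofReal_le_one]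
      have e : s * (1 - 2 ^ 30 * ρ / s) = s - 2 ^ 30 * ρ := by
        field_simp
      have hqρ : q * ρ ≤ 1 * ρ := by gcongr; linarith
      rw [e]
      norm_num
      linarith)
      (hP.tsum_rareEnd_unequalW_le hq hs hqs hq1 hs0 hρ hρ0 hρs) n
      (ENNReal.ofReal (Real.exp (n * ρ / 200))) B (by
      intro x hx
      obtain ⟨k, mn, tv, rl, ha, hM, hw⟩ := (Finset.mem_filter.1 hx).2
      refine ⟨k, mn, tv, rl, ha, hM, ?_⟩
      refine (ENNReal.ofReal_le_ofReal hw).trans (le_of_eq ?_)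
      rw [ENNReal.ofReal_mul (mul_nonneg (by positivity) (pow_nonneg (by norm_num) _)),
        ENNReal.ofReal_mul (by positivity),
        ENNReal.ofReal_pow (by positivity), ENNReal.ofReal_pow (by norm_num),
        ENNReal.ofReal_pow (by linarith)])
  have h3 : {ω | (word X n ω, word Y n ω) ∈ B} = {ω | ∃ k mn tv rl,
      Align o (List.ofFn (word X n ω)) (List.ofFn (word Y n ω)) k mn tv rl
      ∧ MaxCommon (List.ofFn (word X n ω)) (List.ofFn (word Y n ω)) (k + mn) ∧
      Real.exp (n * ρ / 200) ≤
        (1 + ρ / 100) ^ mn * (1 - 1 / 2 ^ 20) ^ tv * (1 - 2 ^ 30 * ρ / s) ^ rl} := by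
    ext ω
    simp [hB]
  rw [h3] at h1
  have h4 := (mul_le_mul_right h1 (ENNReal.ofReal (ρ / 400) *
    ENNReal.ofReal (Real.exp (n * ρ / 200)))).trans h2
  rw [show (2 : ℝ≥0∞) = ENNReal.ofReal 2 by norm_num, ← ENNReal.ofReal_mul (by positivity)] at h4
  refine (toReal_le_of_mul_le (by positivity) (by norm_num) h4).trans (le_of_eq ?_)
  rw [Real.exp_neg]
  field_simp
  norm_num

end Improbable

end LCS

namespace LCS

open scoped ENNReal

/-! ### Parameters -/

section Parameters

theorem K₀_pos : 0 < K₀ := by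
  unfold K₀
  positivity

theorem K₀_le : K₀ ≤ 1 / 2 ^ 70 := by
  have h1 : Real.exp (-67) ≤ 1 / 2 ^ 67 := by
    rw [Real.exp_neg, ← one_div]
    have h2 : (2 : ℝ) ^ 67 ≤ Real.exp 67 := by
      rw [show (67 : ℝ) = (67 : ℕ) * 1 by norm_num, Real.exp_nat_mul]
      have := Real.exp_one_gt_d9
      gcongr
      linarith
    exact one_div_le_one_div_of_le (by positivity) h2
  unfold K₀
  norm_num at h1 ⊢
  linarith

variable {m : ℕ} {p : Fin m → ℝ} {j₀ : Fin m}

theorem le_maxOther {j : Fin m} (hj : j ≠ j₀) : p j ≤ maxOther p j₀ :=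
  le_ciSup (f := fun j : {j : Fin m // j ≠ j₀} => p j) (Set.finite_range _).bddAbove ⟨j, hj⟩

theorem exists_eq_maxOther (h : 0 < maxOther p j₀) : ∃ j, j ≠ j₀ ∧ p j = maxOther p j₀ := by
  have : Nonempty {j : Fin m // j ≠ j₀} := by
    by_contra hne
    rw [not_nonempty_iff] at hne
    simp [maxOther] at h
  obtain ⟨⟨j, hj⟩, h⟩ := exists_eq_ciSup_of_finite (f := fun j : {j : Fin m // j ≠ j₀} => p j)
  exact ⟨j, hj, h⟩

/-- As e⁻⁵ ≤ 1/120, the first term of the minimum gives m · `maxOther p j₀` ≤ `K m` / 480; the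
second claim is then 400/480 < 199/200. -/
theorem maxOther_bounds
    (hmax : maxOther p j₀ ≤ min (2⁻¹ ^ 2 * Real.exp (-5) * K m / m) (K m / (2 * m ^ 2))) :
    m * maxOther p j₀ ≤ 1 / 2 ^ 70 ∧
      400 * maxOther p j₀ ≤ 199 / 100 * (K m / (2 * m)) := by
  have hm : 0 < m := j₀.pos
  have hm' : (0 : ℝ) < m := by exact_mod_cast hm
  have h1 := hmax.trans (min_le_left _ _)
  have hK0 : K m ≤ K₀ := min_le_left _ _
  have hKpos : 0 < K m := lt_min K₀_pos (by positivity)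
  have he : Real.exp (-5) ≤ 1 / 120 := by
    rw [Real.exp_neg, ← one_div]
    refine one_div_le_one_div_of_le (by norm_num) ?_
    rw [show (5 : ℝ) = (5 : ℕ) * 1 by norm_num, Real.exp_nat_mul]
    have := Real.exp_one_gt_d9
    calc (120 : ℝ) ≤ 2.7 ^ 5 := by norm_num
      _ ≤ Real.exp 1 ^ 5 := by gcongr; linarith
  have h2 : m * maxOther p j₀ ≤ K m / 480 := by
    have : m * maxOther p j₀ ≤ 2⁻¹ ^ 2 * Real.exp (-5) * K m := by
      rw [le_div_iff₀ hm'] at h1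
      linarith
    refine this.trans ?_
    have : 2⁻¹ ^ 2 * Real.exp (-5) * K m ≤ 2⁻¹ ^ 2 * (1 / 120) * K m := by gcongr
    linarith
  constructor
  · have := K₀_le
    linarith
  · have : 400 * maxOther p j₀ ≤ 400 * (K m / 480 / m) := by
      gcongr
      rw [le_div_iff₀ hm']
      linarith
    refine this.trans (le_of_sub_nonneg ?_)
    have e : 199 / 100 * (K m / (2 * m)) - 400 * (K m / 480 / m) =
        (199 / 200 - 400 / 480) * (K m / m) := by
      field_simp
      norm_num
    rw [e]
    have : 0 < K m / m := by positivity
    norm_num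
    positivity

/-- The error terms are dominated by the error term of the theorem. -/
theorem error_le {n ρ p : ℝ} (hp0 : 0 < p) (hp : p ≤ 1 / 2 ^ 70) (hρ : p ^ 2 ≤ ρ)
    (hn : 1 ≤ n * p ^ 6 / 5) :
    4 * Real.exp (-(2 * n * (p ^ 2 / 2) ^ 2)) + 2 * Real.exp (-(n * ρ)) +
      800 / ρ * Real.exp (-(n * ρ / 200)) ≤ 121 * Real.exp (-(n * p ^ 6 / 5)) := by
  have hn0 : 0 < n := by
    by_contra h
    have : n * p ^ 6 ≤ 0 := mul_nonpos_of_nonpos_of_nonneg (not_lt.1 h) (by positivity)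
    linarith
  have hp2 : p ^ 2 ≤ 1 / 10 ^ 10 := by
    calc p ^ 2 ≤ (1 / 2 ^ 70) ^ 2 := by gcongr
      _ ≤ 1 / 10 ^ 10 := by norm_num
  have hρ0 : 0 < ρ := lt_of_lt_of_le (by positivity) hρ
  have h6 : p ^ 6 = p ^ 4 * p ^ 2 := by ring
  have h64 : p ^ 6 ≤ p ^ 4 * (1 / 10 ^ 10) := by rw [h6]; gcongr
  have h42 : p ^ 4 ≤ p ^ 2 * (1 / 10 ^ 10) := by
    rw [show p ^ 4 = p ^ 2 * p ^ 2 by ring]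
    gcongr
  have a1 : Real.exp (-(2 * n * (p ^ 2 / 2) ^ 2)) ≤ Real.exp (-(n * p ^ 6 / 5)) := by
    refine Real.exp_le_exp.2 (neg_le_neg ?_)
    have : n * p ^ 6 ≤ n * (p ^ 4 * (1 / 10 ^ 10)) := by gcongr
    have h4 : 0 ≤ n * p ^ 4 := by positivity
    nlinarith
  have b0 : n * p ^ 6 ≤ n * ρ * (1 / 10 ^ 10) := by
    have : n * p ^ 6 ≤ n * (p ^ 4 * (1 / 10 ^ 10)) := by gcongr
    have : n * p ^ 4 ≤ n * (p ^ 2 * (1 / 10 ^ 10)) := by gcongr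
    have : n * p ^ 2 ≤ n * ρ := by gcongr
    have h4 : 0 ≤ n * p ^ 2 := by positivity
    linarith
  have hnρ : 0 < n * ρ := by positivity
  have a2 : Real.exp (-(n * ρ)) ≤ Real.exp (-(n * p ^ 6 / 5)) := by
    refine Real.exp_le_exp.2 (neg_le_neg ?_)
    linarith
  have a3 : 800 / ρ * Real.exp (-(n * ρ / 200)) ≤ Real.exp (-(n * p ^ 6 / 5)) := by
    -- As np⁶ ≥ 5 and p² ≤ 10⁻¹⁰, nρ² ≥ np⁴ ≥ 5·10¹⁰; half of the exponent thus absorbs the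
    -- prefactor.
    have c1 : 800 / ρ ≤ Real.exp (n * ρ / 400) := by
      refine le_trans ?_ ((le_add_of_nonneg_right zero_le_one).trans
        (Real.add_one_le_exp (n * ρ / 400)))
      rw [div_le_iff₀ hρ0]
      have d1 : n * p ^ 4 ≤ n * ρ * ρ := by
        calc n * p ^ 4 = n * p ^ 2 * p ^ 2 := by ring
          _ ≤ n * ρ * ρ := by gcongr
      have d2 : n * p ^ 6 ≤ n * p ^ 4 * (1 / 10 ^ 10) := by
        rw [h6, ← mul_assoc]
        gcongr
      linarith
    calc 800 / ρ * Real.exp (-(n * ρ / 200))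
        ≤ Real.exp (n * ρ / 400) * Real.exp (-(n * ρ / 200)) := by gcongr
      _ = Real.exp (-(n * ρ / 400)) := by
          rw [← Real.exp_add]
          congr 1
          ring
      _ ≤ _ := by
          refine Real.exp_le_exp.2 (neg_le_neg ?_)
          linarith
  have := Real.exp_pos (-(n * p ^ 6 / 5))
  linarith

end Parameters

end LCS

/-! ### Proof of the main theorem -/

open LCS in
theorem theorem2 {Ω : Type*} [MeasurableSpace Ω] (μ : Measure Ω) [IsProbabilityMeasure μ]
    (m : ℕ) (p : Fin m → ℝ) (j₀ : Fin m)
    (X Y : ℕ → Ω → Fin m)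
    (hXm : ∀ i, Measurable (X i)) (hYm : ∀ i, Measurable (Y i))
    (hXind : iIndepFun X μ) (hYind : iIndepFun Y μ)
    (hXY : IndepFun (fun ω i => X i ω) (fun ω i => Y i ω) μ)
    (hXlaw : ∀ i k, μ.real {ω | X i ω = k} = p k)
    (hYlaw : ∀ i k, μ.real {ω | Y i ω = k} = p k)
    (hj₀ : 1 / 2 < p j₀)
    (hmax : LCS.maxOther p j₀ ≤
      min (2⁻¹ ^ 2 * Real.exp (-5) * LCS.K m / m) (LCS.K m / (2 * m ^ 2)))
    (n : ℕ) (hn : 1 ≤ n)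
    (J : Ω → Fin n ⊕ Fin n) (hJm : Measurable J)
    (hJ : LCS.IsUniformPick μ j₀ X Y J) :
    ∃ B : Set ((Fin n → Fin m) × (Fin n → Fin m)),
      1 - 121 * Real.exp (-(n * LCS.maxOther p j₀ ^ 6 / 5)) ≤
        μ.real {ω | (LCS.word X n ω, LCS.word Y n ω) ∈ B} ∧
      ∀ x y, (x, y) ∈ B →
        LCS.K₀ / m ≤ (μ[|LCS.wordsEq X Y x y]).real
          {ω | (LCS.changedLC j₀ X Y J ω : ℤ) - LCS.LC n X Y ω = 1} ∧
        (μ[|LCS.wordsEq X Y x y]).real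
          {ω | (LCS.changedLC j₀ X Y J ω : ℤ) - LCS.LC n X Y ω = -1} ≤
            LCS.K m / (2 * m) := by
  classical
  -- In this case the required probability is at most 1 − 121/e < 0, and the empty set will do.
  -- Otherwise n is large compared with `maxOther p j₀`, which is positive.
  by_cases htriv : n * maxOther p j₀ ^ 6 / 5 < 1
  · refine ⟨∅, ?_, fun x y h => absurd h (Set.notMem_empty _)⟩
    have h1 : Real.exp (-1) ≤ Real.exp (-(n * maxOther p j₀ ^ 6 / 5)) :=
      Real.exp_le_exp.2 (by linarith)
    have h2 : -1 + 1 + 1 / 121 ≤ Real.exp (-1) := by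
      have := Real.exp_neg_one_gt_d9
      linarith
    have h3 : (0 : ℝ) ≤ μ.real {ω | (word X n ω, word Y n ω) ∈
        (∅ : Set ((Fin n → Fin m) × (Fin n → Fin m)))} := measureReal_nonneg
    linarith
  rw [not_lt] at htriv
  set pm := maxOther p j₀ with hpm
  have hp0 : ∀ k, 0 ≤ p k := fun k => hXlaw 0 k ▸ measureReal_nonneg
  have hpm0 : 0 ≤ pm := Real.iSup_nonneg fun j => hp0 j
  have hpos : 0 < pm := by
    refine lt_of_le_of_ne hpm0 fun h => ?_
    rw [← h] at htriv
    norm_num at htriv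
  have hm' : (1 : ℝ) ≤ m := by exact_mod_cast j₀.pos
  obtain ⟨hmpm, hη⟩ := maxOther_bounds hmax
  have hpm1 : pm ≤ 1 / 2 ^ 70 := le_trans (by nlinarith) hmpm
  -- the law of one letter
  let P : Fin m → ENNReal := fun k => ENNReal.ofReal (p k)
  have hXlaw' : ∀ i k, μ {ω | X i ω = k} = P k := fun i k => by
    rw [← ofReal_measureReal, hXlaw]
  have hYlaw' : ∀ i k, μ {ω | Y i ω = k} = P k := fun i k => by
    rw [← ofReal_measureReal, hYlaw]
  have hsum : ∑ k, p k = 1 := by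
    have h := sum_measureReal_preimage_singleton (μ := μ) (f := X 0) Finset.univ
      (fun k _ => hXm 0 (measurableSet_singleton k))
    simp only [Finset.coe_univ, Set.preimage_univ, probReal_univ] at h
    rw [← h]
    exact Finset.sum_congr rfl fun k _ => (hXlaw 0 k).symm
  set s := ∑ k ∈ Finset.univ.erase j₀, p k with hs
  set ρ := ∑ k ∈ Finset.univ.erase j₀, p k ^ 2 with hρ
  have hqs : p j₀ + s = 1 := by
    rw [hs, Finset.add_sum_erase _ _ (Finset.mem_univ j₀), hsum]
  have hPs : ∑ k ∈ Finset.univ.erase j₀, P k = ENNReal.ofReal s := by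
    rw [hs, ENNReal.ofReal_sum_of_nonneg fun k _ => hp0 k]
  have hPρ : coinc j₀ P = ENNReal.ofReal ρ := by
    rw [hρ, ENNReal.ofReal_sum_of_nonneg fun k _ => sq_nonneg _]
    exact Finset.sum_congr rfl fun k _ => (ENNReal.ofReal_pow (hp0 k) 2).symm
  have hlaw : IsLaw j₀ P := by
    refine ⟨?_, ?_⟩
    · rw [← ENNReal.ofReal_sum_of_nonneg fun k _ => hp0 k, hsum, ENNReal.ofReal_one]
    · simp only [P, ne_eq, ENNReal.ofReal_eq_zero, not_le]
      linarith
  obtain ⟨j₁, hj₁, hpj₁⟩ := exists_eq_maxOther hpos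
  have hj₁' : j₁ ∈ Finset.univ.erase j₀ := Finset.mem_erase.2 ⟨hj₁, Finset.mem_univ _⟩
  have hρ0 : pm ^ 2 ≤ ρ := by
    rw [hpm, ← hpj₁]
    exact Finset.single_le_sum (f := fun k => p k ^ 2) (fun k _ => sq_nonneg _) hj₁'
  have hs0 : 0 < s := lt_of_lt_of_le (hpj₁ ▸ hpos)
    (Finset.single_le_sum (f := p) (fun k _ => hp0 k) hj₁')
  have hρs : ρ ≤ pm * s := by
    rw [hρ, hs, Finset.mul_sum]
    refine Finset.sum_le_sum fun k hk => ?_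
    rw [sq]
    exact mul_le_mul_of_nonneg_right (le_maxOther (Finset.ne_of_mem_erase hk)) (hp0 k)
  have hs1 : s ≤ 1 / 2 ^ 70 := by
    refine le_trans ?_ hmpm
    calc s ≤ ∑ k ∈ Finset.univ.erase j₀, pm :=
          Finset.sum_le_sum fun k hk => le_maxOther (Finset.ne_of_mem_erase hk)
      _ ≤ ∑ k : Fin m, pm :=
          Finset.sum_le_sum_of_subset_of_nonneg (Finset.erase_subset _ _) fun _ _ _ => hpm0
      _ = m * pm := by simp
  have hρpos : 0 < ρ := lt_of_lt_of_le (by positivity) hρ0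
  have hps : pm * s ≤ 1 / 2 ^ 70 * s := by gcongr
  have hq1 : 999 / 1000 ≤ p j₀ := by
    norm_num at hs1 ⊢
    linarith
  have hρ1 : ρ ≤ 1 / 1000 := by
    norm_num at hs1 hps ⊢
    linarith
  have hρs' : 2 ^ 30 * ρ ≤ s := by
    norm_num at hps ⊢
    linarith
  have hκ : K₀ / m ≤ 1 / 2 ^ 70 := (div_le_self K₀_pos.le hm').trans K₀_le
  -- the set of good pairs of words
  let L : (Fin n → Fin m) → List (Fin m) := List.ofFn
  let good : (Fin n → Fin m) → (Fin n → Fin m) → Prop := fun x y =>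
    K₀ / m * (rares j₀ (L x) + rares j₀ (L y) : ℝ) ≤
      (incCount j₀ (L x) (L y) (lc x y) + incCount j₀ (L y) (L x) (lc x y) : ℝ) ∧
    (decCount j₀ (L x) (L y) (lc x y) + decCount j₀ (L y) (L x) (lc x y) : ℝ) ≤
      K m / (2 * m) * (rares j₀ (L x) + rares j₀ (L y) : ℝ)
  let typ : (Fin n → Fin m) → Prop := fun x =>
    |((L x).count j₀ : ℝ) - n * p j₀| < n * (pm ^ 2 / 2)
  -- Positive probability is what makes `hJ` applicable, and typicality of the first word ensures
  -- that some letter differs from `j₀`, so that the pick is uniform on a nonempty set.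
  refine ⟨{x | μ (wordsEq X Y x.1 x.2) ≠ 0 ∧ typ x.1 ∧ good x.1 x.2}, ?_, ?_⟩
  · set G := {ω | (word X n ω, word Y n ω) ∈
      {x : (Fin n → Fin m) × (Fin n → Fin m) |
        μ (wordsEq X Y x.1 x.2) ≠ 0 ∧ typ x.1 ∧ good x.1 x.2}} with hG
    have hGm : MeasurableSet G :=
      ((measurable_word hXm n).prodMk (measurable_word hYm n)) .of_discrete
    have hA := measure_many_matches_le hXind hYind hXY hXlaw' hYlaw' hlaw (q := p j₀) rfl hq1 hPρ
      hρpos hρ1 n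
    have hB := measure_few_rares_le hXind hYind hXY hXlaw' hYlaw' hlaw (q := p j₀) rfl hPs hqs hq1
      hs0 hPρ hρpos hρ1 hρs' n
    have hCX := measure_abs_count_sub_ge_le hXm hXind j₀ (fun i => hXlaw i j₀) hn
      (ε := pm ^ 2 / 2) (by positivity)
    have hCY := measure_abs_count_sub_ge_le hYm hYind j₀ (fun i => hYlaw i j₀) hn
      (ε := pm ^ 2 / 2) (by positivity)
    set EA := {ω | ∃ k mn tv rl, Align j₀ (List.ofFn (word X n ω)) (List.ofFn (word Y n ω))
      k mn tv rl ∧ Real.exp (n * ρ) ≤ 16 ^ k * 2⁻¹ ^ tv * (1 - 200 * ρ) ^ mn} with hEA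
    set EB := {ω | ∃ k mn tv rl, Align j₀ (List.ofFn (word X n ω)) (List.ofFn (word Y n ω))
      k mn tv rl ∧ MaxCommon (List.ofFn (word X n ω)) (List.ofFn (word Y n ω)) (k + mn) ∧
      Real.exp (n * ρ / 200) ≤
        (1 + ρ / 100) ^ mn * (1 - 1 / 2 ^ 20) ^ tv * (1 - 2 ^ 30 * ρ / s) ^ rl} with hEB
    set EX := {ω | n * (pm ^ 2 / 2) ≤ |((List.ofFn (word X n ω)).count j₀ : ℝ) - n * p j₀|}
      with hEX
    set EY := {ω | n * (pm ^ 2 / 2) ≤ |((List.ofFn (word Y n ω)).count j₀ : ℝ) - n * p j₀|}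
      with hEY
    set E0 := {ω | μ (wordsEq X Y (word X n ω) (word Y n ω)) = 0} with hE0
    have h0 : μ.real E0 = 0 := by
      have : E0 ⊆ ⋃ x ∈ {x : (Fin n → Fin m) × (Fin n → Fin m) | μ (wordsEq X Y x.1 x.2) = 0},
          wordsEq X Y x.1 x.2 := by
        intro ω hω
        simp only [Set.mem_iUnion]
        exact ⟨(word X n ω, word Y n ω), hω, rfl, rfl⟩
      rw [measureReal_eq_zero_iff]
      refine measure_mono_null this ?_
      rw [measure_biUnion_null_iff (Set.toFinite _).countable]
      exact fun x hx => hx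
    have hsub : Gᶜ ⊆ (((E0 ∪ EX) ∪ EY) ∪ EA) ∪ EB := by
      intro ω hω
      by_contra hc
      simp only [Set.mem_union, not_or] at hc
      obtain ⟨⟨⟨⟨c0, cX⟩, cY⟩, cA⟩, cB⟩ := hc
      simp only [hEX, hEY, Set.mem_ofPred_eq, not_le] at cX cY
      rcases inc_dec_or_exists_align (n := n) (by simp) (by simp)
        (commonSublist_lc (word X n ω) (word Y n ω)) (maxCommon_lc (word X n ω) (word Y n ω)) hqs
        hpos hpm1 hρ0 hρs hs1 hκ hη cX.le cY.le with h | h | h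
      · exact hω ⟨c0, cX, h⟩
      · exact cA h
      · exact cB h
    have hle : μ.real Gᶜ ≤ μ.real E0 + μ.real EX + μ.real EY + μ.real EA + μ.real EB := by
      refine (measureReal_mono hsub).trans ?_
      refine (measureReal_union_le _ _).trans (add_le_add_left ?_ _)
      refine (measureReal_union_le _ _).trans (add_le_add_left ?_ _)
      refine (measureReal_union_le _ _).trans (add_le_add_left ?_ _)
      exact measureReal_union_le _ _
    rw [probReal_compl_eq_one_sub hGm] at hle
    have herr := error_le (n := n) hpos hpm1 hρ0 htriv
    linarith
  · rintro x y ⟨hμ, htyp, hinc, hdec⟩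
    have hcard := card_otherPositions j₀ x y
    have hpos' : 0 < rares j₀ (L x) := by
      have h1 := count_add_rares j₀ (L x)
      have h2 : (((L x).count j₀ : ℕ) : ℝ) < n := by
        have h3 := (abs_lt.1 htyp).2
        have hn0 : (1 : ℝ) ≤ n := by exact_mod_cast hn
        have h4 : pm ^ 2 / 2 ≤ s := by
          have : pm ^ 2 ≤ pm * s := hρ0.trans hρs
          norm_num at hps
          linarith
        have h5 : (n : ℝ) * (pm ^ 2 / 2) ≤ n * s := by gcongr
        have h6 : (n : ℝ) * p j₀ + n * s = n := by rw [← mul_add, hqs, mul_one]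
        linarith
      have h3 : (L x).count j₀ < n := by exact_mod_cast h2
      have h4 : (L x).length = n := List.length_ofFn
      omega
    have hN : (0 : ℝ) < rares j₀ (L x) + rares j₀ (L y) := by positivity
    have hne : (otherPositions j₀ x y).Nonempty := by
      have : 0 < (Finset.univ.filter fun t => t ∈ otherPositions j₀ x y).card := by
        rw [hcard]
        exact Nat.add_pos_left hpos' _
      obtain ⟨t, ht⟩ := Finset.card_pos.1 this
      exact ⟨t, (Finset.mem_filter.1 ht).2⟩
    have hcardR : ((Finset.univ.filter fun t => t ∈ otherPositions j₀ x y).card : ℝ) =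
        rares j₀ (L x) + rares j₀ (L y) := by exact_mod_cast hcard
    rw [cond_changedLC_sub_LC hXm hYm j₀ hJm hJ hμ hne,
      cond_changedLC_sub_LC hXm hYm j₀ hJm hJ hμ hne, hcardR]
    constructor
    · rw [le_div_iff₀ hN]
      exact hinc.trans (by exact_mod_cast card_inc_ge j₀ x y)
    · rw [div_le_iff₀ hN]
      exact le_trans (by exact_mod_cast card_dec_le j₀ x y) hdec
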